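/- Let $G$ be a topological group whose topology is induced by a left-invariant metric $d$ (i.e. $d(gx,gy)=d(x,y)$ for all $g,x,y\in G$), and let $e$ be the identity of $G$. Assume that $d$ is *stable*: for all sequences $(s_n)_{n\in\mathbb N}$, $(t_m)_{m\in\mathbb N}$ in $G$ that are bounded (there is $M$ with $d(e,s_n)\le M$ and $d(e,t_m)\le M$ for all $n,m$) and for all ultrafilters $\mathcal U,\mathcal V$ on $\mathbb N$, $$\lim_{n,\mathcal U}\,\lim_{m,\mathcal V} d(s_n,t_m)=\lim_{m,\mathcal V}\,\lim_{n,\mathcal U} d(s_n,t_m).$$ Then $G$ is reflexively representable: for each scalar field $\mathbb K\in\{\mathbb R,\mathbb C\}$ there are a reflexive Banach space $E$ over $\mathbb K$ and a group homomorphism $\varphi$ from $G$ into the group $\mathrm{Iso}(E)$ of linear isometries of $E$ onto itself such that $\varphi$ is a homeomorphism onto its image both when $\mathrm{Iso}(E)$ carries the strong operator topology (the coarsest one making all maps $T\mapsto Tv$, $v\in E$, norm continuous) and when it carries the weak operator topology (the coarsest one making all maps $T\mapsto f(Tv)$, $v\in E$, $f\in E^*$, continuous). -/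

import Mathlib

open Filter Topology

universe u

/-- A metric on a group `G` is *stable* if for all bounded sequences `s`, `t` in `G` and all
ultrafilters `U`, `V` on `ℕ`,
`lim_{n, U} lim_{m, V} d (s n, t m) = lim_{m, V} lim_{n, U} d (s n, t m)`.
The inner limits are `a n` and `b m`, the outer limits are `L` and `L'`; all of them exist,
because the double sequence `d (s n, t m)` is bounded. -/
def IsStableMetric (G : Type u) [Group G] [MetricSpace G] : Prop :=
  ∀ s t : ℕ → G,
    (∃ M : ℝ, (∀ n, dist 1 (s n) ≤ M) ∧ ∀ m, dist 1 (t m) ≤ M) →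
    ∀ (U V : Ultrafilter ℕ) (a b : ℕ → ℝ) (L L' : ℝ),
      (∀ n, Tendsto (fun m => dist (s n) (t m)) V (𝓝 (a n))) →
      Tendsto a U (𝓝 L) →
      (∀ m, Tendsto (fun n => dist (s n) (t m)) U (𝓝 (b m))) →
      Tendsto b V (𝓝 L') →
      L = L'

/-- A Banach space is *reflexive* if the canonical map into its bidual is onto. -/
def IsReflexiveBanach (𝕜 : Type) [RCLike 𝕜] (E : Type u) [NormedAddCommGroup E]
    [NormedSpace 𝕜 E] : Prop :=
  CompleteSpace E ∧ Function.Surjective (NormedSpace.inclusionInDoubleDual 𝕜 E)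

/-- A linear isometry of `E` onto itself, as an element of the space of bounded operators
with the strong operator topology (the topology of pointwise norm convergence). -/
noncomputable def isometryToSOT {𝕜 : Type} [RCLike 𝕜] {E : Type u} [NormedAddCommGroup E]
    [NormedSpace 𝕜 E] (T : E ≃ₗᵢ[𝕜] E) : E →Lₚₜ[𝕜] E :=
  ContinuousLinearMap.toPointwiseConvergenceCLM 𝕜 (RingHom.id 𝕜) E E
    (T.toContinuousLinearEquiv : E →L[𝕜] E)

/-- A linear isometry of `E` onto itself, as an element of the space of bounded operators
with the weak operator topology (induced by the maps `T ↦ f (T v)`, `v ∈ E`, `f ∈ E*`). -/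
def isometryToWOT {𝕜 : Type} [RCLike 𝕜] {E : Type u} [NormedAddCommGroup E]
    [NormedSpace 𝕜 E] (T : E ≃ₗᵢ[𝕜] E) : E →WOT[𝕜] E :=
  ContinuousLinearMapWOT.ofCLM (T.toContinuousLinearEquiv : E →L[𝕜] E)

/-- A topological group `G` is *reflexively representable* (over `𝕜 = ℝ` or `ℂ`) if there is a
group homomorphism of `G` into the group of linear isometries of some reflexive Banach space `E`
onto itself which is a homeomorphism onto its image, the isometry group being equipped with the
strong, and also when it is equipped with the weak, operator topology. -/
def ReflexivelyRepresentable (𝕜 : Type) [RCLike 𝕜] (G : Type u) [Group G]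
    [TopologicalSpace G] : Prop :=
  ∃ (E : Type u) (_ : NormedAddCommGroup E) (_ : NormedSpace 𝕜 E),
    IsReflexiveBanach 𝕜 E ∧
    ∃ φ : G →* (E ≃ₗᵢ[𝕜] E),
      IsEmbedding (fun g => isometryToSOT (φ g)) ∧
      IsEmbedding (fun g => isometryToWOT (φ g))

/-- Bounded nonnegative functions on `ℕ` which tend to zero at every ultrafilter have convex
combinations which are uniformly small. -/
theorem exists_convexComb_le_of_ultrafilter_tendsto_zero {h : ℕ → ℕ → ℝ} {C : ℝ}
    (h_nonneg : ∀ j k, 0 ≤ h j k) (h_le : ∀ j k, h j k ≤ C)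
    (h_lim : ∀ (V : Ultrafilter ℕ) (a : ℕ → ℝ), (∀ j, Tendsto (h j) V (𝓝 (a j))) →
      Tendsto a atTop (𝓝 0)) {ε : ℝ} (hε : 0 < ε) :
    ∃ w : ℕ →₀ ℝ, (∀ j, 0 ≤ w j) ∧ (w.sum fun _ c => c) = 1 ∧
      ∀ k, (w.sum fun j c => c * h j k) ≤ ε := by
  classical
  let K := Ultrafilter ℕ
  let hI : ℕ → ℕ → Set.Icc (0 : ℝ) C := fun j k => ⟨h j k, h_nonneg j k, h_le j k⟩
  let H : ℕ → C(K, ℝ) := fun j =>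
    ⟨fun V => (Ultrafilter.extend (hI j) V).1,
      continuous_subtype_val.comp (continuous_ultrafilter_extend (hI j))⟩
  have H_pure : ∀ j k, H j (pure k : Ultrafilter ℕ) = h j k := fun j k => by
    have := congrFun (ultrafilter_extend_extends (hI j)) k
    simp only [Function.comp_apply] at this
    simp [H, this, hI]
  have H_nonneg : ∀ j V, 0 ≤ H j V := fun j V => (Ultrafilter.extend (hI j) V).2.1
  have H_le : ∀ j V, H j V ≤ C := fun j V => (Ultrafilter.extend (hI j) V).2.2
  have H_lim : ∀ V : K, Tendsto (fun j => H j V) atTop (𝓝 0) := fun V => by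
    refine h_lim V _ fun j => ?_
    have : (V.map (hI j) : Filter _) ≤ 𝓝 (Ultrafilter.extend (hI j) V) :=
      (ultrafilter_extend_eq_iff (f := hI j) (b := V)).1 rfl
    exact (continuous_subtype_val.tendsto _).comp this
  by_contra! hcon
  let D : Set C(K, ℝ) := (Finsupp.linearCombination ℝ H) ''
    {w : ℕ →₀ ℝ | (∀ j, 0 ≤ w j) ∧ (w.sum fun _ c => c) = 1}
  have sum_eq : ∀ w : ℕ →₀ ℝ, (w.sum fun _ c => c) = Finsupp.linearCombination ℝ (fun _ => (1 : ℝ)) w :=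
    fun w => by simp [Finsupp.linearCombination_apply]
  have hD : Convex ℝ D := by
    refine Convex.linear_image ?_ _
    intro w hw v hv a b ha hb hab
    refine ⟨fun j => ?_, ?_⟩
    · have h1 := hw.1 j
      have h2 := hv.1 j
      simp only [Finsupp.add_apply, Finsupp.smul_apply, smul_eq_mul]
      positivity
    · have h1 := hw.2
      have h2 := hv.2
      rw [sum_eq] at h1 h2 ⊢
      rw [map_add, map_smul, map_smul, h1, h2]
      simpa using hab
  let N : Set C(K, ℝ) := {f | ∀ V, f V < ε}
  have hN : IsOpen N := by
    have : N = {f : C(K, ℝ) | Set.MapsTo f Set.univ (Set.Iio ε)} := by ext; simp [N, Set.MapsTo]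
    rw [this]
    exact ContinuousMap.isOpen_setOfPred_mapsTo isCompact_univ isOpen_Iio
  have hNc : Convex ℝ N := by
    intro f hf g hg a b ha hb hab V
    have h1 := hf V
    have h2 := hg V
    simp only [ContinuousMap.add_apply, ContinuousMap.smul_apply, smul_eq_mul]
    rcases ha.eq_or_lt with rfl | ha
    · simp at hab; subst hab; simpa using h2
    · nlinarith
  have hdisj : Disjoint N D := by
    rw [Set.disjoint_left]
    rintro _ hf ⟨w, hw, rfl⟩
    obtain ⟨k, hk⟩ := hcon w hw.1 hw.2
    have := hf (pure k : Ultrafilter ℕ)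
    simp only [Finsupp.linearCombination_apply, Finsupp.sum, ContinuousMap.sum_apply,
      ContinuousMap.smul_apply, H_pure, smul_eq_mul] at this
    simp only [Finsupp.sum] at hk
    linarith
  obtain ⟨φ, r, hφN, hφD⟩ := geometric_hahn_banach_open hNc hN hD hdisj
  have hr : 0 < r := by simpa using hφN 0 (fun V => by simpa using hε)
  have hφ : ∀ f : C(K, ℝ), 0 ≤ f → 0 ≤ φ f := by
    intro f hf
    by_contra! hneg
    have := hφN ((r / φ f) • f) (fun V => by
      have : r / φ f ≤ 0 := div_nonpos_of_nonneg_of_nonpos hr.le hneg.le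
      have h2 : 0 ≤ f V := hf V
      simp only [ContinuousMap.smul_apply, smul_eq_mul]
      nlinarith)
    rw [map_smul, smul_eq_mul, div_mul_cancel₀ _ hneg.ne] at this
    exact lt_irrefl _ this
  let Λ : CompactlySupportedContinuousMap K ℝ →ₚ[ℝ] ℝ := PositiveLinearMap.mk₀
    { toFun := fun f => φ f.toContinuousMap
      map_add' := fun f g => φ.map_add _ _
      map_smul' := fun c f => φ.map_smul c _ } (fun f hf => hφ _ hf)
  let : MeasurableSpace K := borel K
  have : BorelSpace K := ⟨rfl⟩
  let μ := RealRMK.rieszMeasure Λ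
  have hμ : ∀ j, ∫ V, H j V ∂μ = φ (H j) := fun j =>
    RealRMK.integral_rieszMeasure Λ (CompactlySupportedContinuousMap.continuousMapEquiv (H j))
  have hint : Tendsto (fun j => ∫ V, H j V ∂μ) atTop (𝓝 (∫ _, (0 : ℝ) ∂μ)) := by
    refine MeasureTheory.tendsto_integral_of_dominated_convergence (fun _ => C) ?_ ?_ ?_ ?_
    · exact fun j => (H j).continuous.aestronglyMeasurable
    · exact MeasureTheory.integrable_const C
    · exact fun j => Eventually.of_forall fun V => by
        rw [Real.norm_of_nonneg (H_nonneg j V)]; exact H_le j V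
    · exact Eventually.of_forall H_lim
  simp only [hμ, MeasureTheory.integral_zero] at hint
  have hge : ∀ j, r ≤ φ (H j) := fun j => hφD _ ⟨Finsupp.single j 1, ⟨fun i => by
    rw [Finsupp.single_apply]; split_ifs <;> norm_num, by simp⟩, by simp⟩
  exact absurd (ge_of_tendsto' hint hge) (not_le.2 hr)

section Bidual

variable {𝕜 : Type*} [RCLike 𝕜] {Y : Type*} [NormedAddCommGroup Y] [NormedSpace 𝕜 Y]

/-- **Helly's lemma**: finitely many values of an element of the bidual are approximated by the
values of an element of the space of almost the same norm. -/
theorem exists_norm_le_forall_norm_sub_lt {ι : Type*} [Finite ι]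
    (ξ : StrongDual 𝕜 (StrongDual 𝕜 Y)) (f : ι → StrongDual 𝕜 Y) {M ε : ℝ} (hM : ‖ξ‖ ≤ M)
    (hε : 0 < ε) : ∃ y : Y, ‖y‖ ≤ M ∧ ∀ i, ‖f i y - ξ (f i)‖ < ε := by
  have := Fintype.ofFinite ι
  classical
  have hM0 : 0 ≤ M := (norm_nonneg ξ).trans hM
  let L : Y →L[𝕜] (ι → 𝕜) := ContinuousLinearMap.pi f
  let z : ι → 𝕜 := fun i => ξ (f i)
  let : NormedSpace ℝ Y := NormedSpace.restrictScalars ℝ 𝕜 Y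
  have : IsScalarTower ℝ 𝕜 Y := RestrictScalars.isScalarTower _ _ _
  by_cases hz : z ∈ closure (L '' Metric.closedBall 0 M)
  · obtain ⟨_, ⟨y, hy, rfl⟩, hyz⟩ := Metric.mem_closure_iff.1 hz ε hε
    refine ⟨y, by simpa using hy, fun i => ?_⟩
    rw [dist_comm, dist_eq_norm] at hyz
    exact (norm_le_pi_norm (L y - z) i).trans_lt hyz
  · exfalso
    have hconv : Convex ℝ (closure (L '' Metric.closedBall 0 M)) :=
      ((convex_closedBall (0 : Y) M).linear_image ((L : Y →ₗ[𝕜] (ι → 𝕜)).restrictScalars ℝ)).closure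
    obtain ⟨l, u, hl, hu⟩ := RCLike.geometric_hahn_banach_closed_point (𝕜 := 𝕜) hconv isClosed_closure hz
    let c : ι → 𝕜 := fun i => l (Pi.single i 1)
    have hlc : ∀ x, l x = ∑ i, c i * x i := fun x => by
      conv_lhs => rw [← Finset.univ_sum_single x]
      rw [map_sum]
      refine Finset.sum_congr rfl fun i _ => ?_
      rw [mul_comm, ← smul_eq_mul, ← map_smul, ← Pi.single_smul, smul_eq_mul, mul_one]
    let g : StrongDual 𝕜 Y := ∑ i, c i • f i
    have hg : ∀ y, l (L y) = g y := fun y => by simp [hlc, g, L]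
    have hξ : l z = ξ g := by simp [hlc, g, z]
    have hu0 : 0 < u := by
      simpa using hl (L 0) (subset_closure ⟨0, by simp [hM0], rfl⟩)
    have hgy : ∀ y, ‖y‖ ≤ M → ‖g y‖ ≤ u := fun y hy => by
      obtain ⟨c, hc, hcy⟩ := RCLike.exists_norm_eq_mul_self (g y)
      have := hl (L (c • y)) (subset_closure ⟨c • y, by simpa [norm_smul, hc] using hy, rfl⟩)
      rw [hg, map_smul, smul_eq_mul, ← hcy, RCLike.ofReal_re] at this
      exact this.le
    have hgu : M * ‖g‖ ≤ u := by
      rcases hM0.eq_or_lt with h | hMpos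
      · simpa [← h] using hu0.le
      · rw [mul_comm, ← le_div_iff₀ hMpos]
        refine ContinuousLinearMap.opNorm_le_of_unit_norm (by positivity) fun y hy => ?_
        have := hgy ((M : 𝕜) • y) (by simp [norm_smul, hy, abs_of_pos hMpos])
        rw [map_smul, norm_smul, RCLike.norm_ofReal, abs_of_pos hMpos] at this
        rwa [le_div_iff₀ hMpos, mul_comm]
    have h1 : RCLike.re (ξ g) ≤ M * ‖g‖ :=
      (RCLike.re_le_norm _).trans ((ξ.le_opNorm g).trans (by gcongr))
    rw [hξ] at hu
    linarith

/-- A point outside a closed subspace is separated from it by a functional. -/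
theorem Submodule.exists_dual_eq_one_of_notMem (S : Submodule 𝕜 Y) (hS : IsClosed (S : Set Y))
    {y : Y} (hy : y ∉ S) : ∃ φ : StrongDual 𝕜 Y, (∀ s ∈ S, φ s = 0) ∧ φ y = 1 := by
  have hne : ‖(S.mkQ y : Y ⧸ S)‖ ≠ 0 := fun h =>
    hy <| (QuotientAddGroup.norm_mk_eq_zero (S := S.toAddSubgroup) (hS := hS)).1 h
  obtain ⟨g, -, hg⟩ := exists_dual_vector 𝕜 (S.mkQ y) hne
  refine ⟨((‖S.mkQ y‖ : 𝕜)⁻¹) • g.comp S.mkQL, fun s hs => ?_, ?_⟩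
  · have : S.mkQL s = 0 := (Submodule.Quotient.mk_eq_zero S).2 hs
    simp [this]
  · have : S.mkQL y = S.mkQ y := rfl
    have h0 : (‖S.mkQ y‖ : 𝕜) ≠ 0 := by exact_mod_cast hne
    simp only [smul_apply, ContinuousLinearMap.comp_apply, this, hg, smul_eq_mul]
    exact inv_mul_cancel₀ h0

theorem LinearIsometry.exists_dual_eq_one_of_notMem_range [CompleteSpace Y] {Z : Type*}
    [NormedAddCommGroup Z] [NormedSpace 𝕜 Z] (J : Y →ₗᵢ[𝕜] Z) {z : Z} (hz : z ∉ Set.range J) :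
    ∃ φ : StrongDual 𝕜 Z, (∀ y, φ (J y) = 0) ∧ φ z = 1 := by
  have hclosed : IsClosed (LinearMap.range J.toLinearMap : Set Z) :=
    J.isometry.isUniformInducing.isComplete_range.isClosed
  obtain ⟨φ, h0, h1⟩ := Submodule.exists_dual_eq_one_of_notMem _ hclosed (y := z) hz
  exact ⟨φ, fun y => h0 _ ⟨y, rfl⟩, h1⟩

theorem LinearIsometry.exists_bidual_eq_one_of_notMem_range [CompleteSpace Y] {Z : Type*}
    [NormedAddCommGroup Z] [NormedSpace 𝕜 Z] (J : Y →ₗᵢ[𝕜] StrongDual 𝕜 Z) {ξ : StrongDual 𝕜 Z}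
    (hξ : ξ ∉ Set.range J) :
    ∃ φ : StrongDual 𝕜 (StrongDual 𝕜 Z), (∀ y, φ (J y) = 0) ∧ φ ξ = 1 :=
  LinearIsometry.exists_dual_eq_one_of_notMem_range (Z := StrongDual 𝕜 Z) J hξ

/-- If `ξ` in the bidual of `Y` is not represented by an element of `Y`, then any set of elements
approximating `ξ` contains one half of a pair of sequences as in James' characterisation of
reflexivity. -/
theorem exists_order_sequences_of_notMem_range [CompleteSpace Y]
    (ξ : StrongDual 𝕜 (StrongDual 𝕜 Y)) (hξ : ¬ ∃ y : Y, ∀ f, ξ f = f y)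
    {A : Set Y} (hA : ∀ (s : Finset (StrongDual 𝕜 Y)) (ε : ℝ), 0 < ε →
      ∃ y ∈ A, ∀ f ∈ s, ‖f y - ξ f‖ < ε) {ε : ℝ} (hε : 0 < ε) :
    ∃ (C : ℝ) (f : ℕ → StrongDual 𝕜 Y) (x : ℕ → Y), (∀ j, ‖f j‖ ≤ C) ∧ (∀ i, x i ∈ A) ∧
      (∀ i j, i < j → ‖f j (x i)‖ < ε) ∧ (∀ i j, j ≤ i → ‖f j (x i) - 1‖ < ε) := by
  classical
  let J := NormedSpace.inclusionInDoubleDualLi (E := Y) 𝕜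
  have hnot : ξ ∉ Set.range J := fun ⟨y, hy⟩ => hξ ⟨y, fun f => by rw [← hy]; rfl⟩
  obtain ⟨φ, hφ0, hφ1⟩ := LinearIsometry.exists_bidual_eq_one_of_notMem_range _ hnot
  obtain ⟨F, hFP, hFr⟩ := exists_seq_of_forall_finset_exists
    (fun p : StrongDual 𝕜 Y × Y => ‖p.1‖ ≤ ‖φ‖ ∧ p.2 ∈ A ∧ ‖ξ p.1 - 1‖ < ε / 2 ∧
      ‖p.1 p.2 - 1‖ < ε)
    (fun p q => ‖q.1 p.2‖ < ε ∧ ‖p.1 q.2 - 1‖ < ε) (by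
      intro s hs
      obtain ⟨f, hfn, hf⟩ := exists_norm_le_forall_norm_sub_lt φ
        (fun i : Option s => i.elim ξ fun p => J p.1.2) le_rfl (half_pos hε)
      have hfξ : ‖ξ f - 1‖ < ε / 2 := by simpa [hφ1] using hf none
      obtain ⟨y, hyA, hy⟩ := hA (insert f (s.image Prod.fst)) (ε / 2) (half_pos hε)
      have key : ∀ g : StrongDual 𝕜 Y, g ∈ insert f (s.image Prod.fst) → ‖ξ g - 1‖ < ε / 2 →
          ‖g y - 1‖ < ε := fun g hg hg1 => by
        calc ‖g y - 1‖ = ‖(g y - ξ g) + (ξ g - 1)‖ := by ring_nf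
          _ ≤ ‖g y - ξ g‖ + ‖ξ g - 1‖ := norm_add_le _ _
          _ < ε := by linarith [hy g hg]
      refine ⟨(f, y), ⟨hfn, hyA, hfξ, key f (by simp) hfξ⟩, fun p hp => ⟨?_, ?_⟩⟩
      · have h1 := hf (some ⟨p, hp⟩)
        have h2 : φ (J p.2) = 0 := hφ0 p.2
        simp only [Option.elim, h2, sub_zero] at h1
        exact (show ‖f p.2‖ < ε / 2 from h1).trans (half_lt_self hε)
      · exact key p.1 (Finset.mem_insert_of_mem (Finset.mem_image_of_mem _ hp)) (hs p hp).2.2.1)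
  refine ⟨‖φ‖, fun j => (F j).1, fun i => (F i).2, fun j => (hFP j).1, fun i => (hFP i).2.1,
    fun i j hij => (hFr i j hij).1, fun i j hji => ?_⟩
  rcases hji.eq_or_lt with rfl | hji
  · exact (hFP j).2.2.2
  · exact (hFr j i hji).2

end Bidual

theorem Ultrafilter.exists_tendsto_of_norm_le {ι E : Type*} [NormedAddCommGroup E] [ProperSpace E]
    (U : Ultrafilter ι) {g : ι → E} {C : ℝ} (hg : ∀ i, ‖g i‖ ≤ C) :
    ∃ z : E, ‖z‖ ≤ C ∧ Tendsto g U (𝓝 z) := by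
  obtain ⟨z, hz, hU⟩ := (isCompact_closedBall (0 : E) C).ultrafilter_le_nhds' (U.map g)
    (Ultrafilter.mem_map.2 <| Filter.univ_mem' fun i => by simpa using hg i)
  exact ⟨z, by simpa using hz, hU⟩

theorem Ultrafilter.exists_dual_tendsto_of_norm_le {𝕜 ι X : Type*} [RCLike 𝕜]
    [NormedAddCommGroup X] [NormedSpace 𝕜 X] (U : Ultrafilter ι) {f : ι → StrongDual 𝕜 X} {C : ℝ}
    (hf : ∀ i, ‖f i‖ ≤ C) : ∃ g : StrongDual 𝕜 X, ∀ x, Tendsto (fun i => f i x) U (𝓝 (g x)) := by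
  obtain ⟨z, -, hU⟩ := (WeakDual.isCompact_closedBall (𝕜 := 𝕜) (0 : StrongDual 𝕜 X) C).ultrafilter_le_nhds'
    (U.map fun i => StrongDual.toWeakDual (f i))
    (Ultrafilter.mem_map.2 <| Filter.univ_mem' fun i => by simpa using hf i)
  exact ⟨WeakDual.toStrongDual z, fun x => ((WeakDual.eval_continuous x).tendsto z).comp hU⟩

/-- A real kernel is *stable* if its iterated limits along ultrafilters can be interchanged. -/
def IsStableKernel {S T : Type*} (F : S → T → ℝ) : Prop :=
  ∀ (s : ℕ → S) (t : ℕ → T) (U V : Ultrafilter ℕ) (a b : ℕ → ℝ) (L L' : ℝ),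
    (∀ n, Tendsto (fun m => F (s n) (t m)) V (𝓝 (a n))) → Tendsto a U (𝓝 L) →
    (∀ m, Tendsto (fun n => F (s n) (t m)) U (𝓝 (b m))) → Tendsto b V (𝓝 L') → L = L'

section

variable {S T : Type*} (𝕜 : Type*) [RCLike 𝕜]

/-- A bounded real function, as a bounded function with values in `𝕜`. -/
noncomputable def lpInftyOfReal (φ : T → ℝ) (C : ℝ) (hφ : ∀ t, |φ t| ≤ C) :
    lp (fun _ : T => 𝕜) ⊤ :=
  ⟨fun t => (φ t : 𝕜), memℓp_infty ⟨C, by rintro _ ⟨t, rfl⟩; simpa using hφ t⟩⟩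

variable {𝕜}

@[simp]
theorem lpInftyOfReal_apply (φ : T → ℝ) (C : ℝ) (hφ : ∀ t, |φ t| ≤ C) (t : T) :
    lpInftyOfReal 𝕜 φ C hφ t = (φ t : 𝕜) := rfl

theorem norm_lpInftyOfReal_le (φ : T → ℝ) (C : ℝ) (hC : 0 ≤ C) (hφ : ∀ t, |φ t| ≤ C) :
    ‖lpInftyOfReal 𝕜 φ C hφ‖ ≤ C :=
  lp.norm_le_of_forall_le hC fun t => by simpa using hφ t

/-- The norm on a separable set of bounded functions is computed on countably many points. -/
theorem TopologicalSpace.IsSeparable.exists_norming_seq [Nonempty T]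
    {Y : Set (lp (fun _ : T => 𝕜) ⊤)} (hY : TopologicalSpace.IsSeparable Y) :
    ∃ t : ℕ → T, ∀ y ∈ Y, ∀ c : ℝ, (∀ k, ‖y (t k)‖ ≤ c) → ‖y‖ ≤ c := by
  obtain ⟨D, hD, hYD⟩ := hY
  have hpt : ∀ (d : lp (fun _ : T => 𝕜) ⊤) (n : ℕ), ∃ t : T, ‖d‖ ≤ ‖d t‖ + 1 / ((n : ℝ) + 1) := by
    intro d n
    by_contra! hcon
    have hpos : 0 < 1 / ((n : ℝ) + 1) := by positivity
    have : ‖d‖ ≤ ‖d‖ - 1 / ((n : ℝ) + 1) :=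
      lp.norm_le_of_forall_le' _ fun t => by linarith [hcon t]
    linarith
  choose p hp using hpt
  obtain ⟨t, ht⟩ := ((hD.prod (Set.countable_univ (α := ℕ))).image fun q => p q.1 q.2).insert
    (Classical.arbitrary T) |>.exists_eq_range (Set.insert_nonempty _ _)
  refine ⟨t, fun y hy c hc => le_of_forall_pos_le_add fun ε hε => ?_⟩
  obtain ⟨d, hd, hyd⟩ := Metric.mem_closure_iff.1 (hYD hy) (ε / 3) (by positivity)
  obtain ⟨n, hn⟩ := exists_nat_one_div_lt (show 0 < ε / 3 by positivity)
  obtain ⟨k, hk⟩ : p d n ∈ Set.range t :=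
    ht ▸ Set.mem_insert_of_mem _ ⟨(d, n), ⟨hd, Set.mem_univ _⟩, rfl⟩
  rw [dist_eq_norm] at hyd
  have h1 : ‖d (p d n)‖ ≤ ‖y (p d n)‖ + ‖y - d‖ := by
    have h2 : ‖(y - d) (p d n)‖ ≤ ‖y - d‖ := lp.norm_apply_le_norm ENNReal.top_ne_zero _ _
    have h3 : d (p d n) = y (p d n) - (y - d) (p d n) := by
      rw [lp.coeFn_sub, Pi.sub_apply, sub_sub_cancel]
    rw [h3]
    exact (norm_sub_le _ _).trans (by gcongr)
  have h4 : ‖y‖ ≤ ‖d‖ + ‖y - d‖ := by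
    simpa using norm_add_le d (y - d)
  have h5 := hp d n
  have h6 := hc k
  rw [hk] at h6
  linarith

variable {F : S → T → ℝ} {C : ℝ}

/-- The rows of a stable kernel converge weakly as soon as they converge pointwise. -/
theorem IsStableKernel.tendsto_dual_apply [Nonempty T] (hF : IsStableKernel F)
    (hC : ∀ s t, |F s t| ≤ C) (s : ℕ → S) (U : Ultrafilter ℕ) (φ : T → ℝ) (hφC : ∀ t, |φ t| ≤ C)
    (hφ : ∀ t, Tendsto (fun n => F (s n) t) U (𝓝 (φ t)))
    (f : StrongDual 𝕜 (lp (fun _ : T => 𝕜) ⊤)) :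
    Tendsto (fun n => f (lpInftyOfReal 𝕜 (F (s n)) C (hC (s n)))) U
      (𝓝 (f (lpInftyOfReal 𝕜 φ C hφC))) := by
  have hC0 : 0 ≤ C := (abs_nonneg _).trans (hφC (Classical.arbitrary T))
  set R : ℕ → lp (fun _ : T => 𝕜) ⊤ := fun n => lpInftyOfReal 𝕜 (F (s n)) C (hC (s n)) with hR
  set Φ := lpInftyOfReal 𝕜 φ C hφC with hΦ
  obtain ⟨z, -, hz⟩ := U.exists_tendsto_of_norm_le (g := fun n => f (R n)) (C := ‖f‖ * C)
    fun n => (f.le_opNorm _).trans (by gcongr; exact norm_lpInftyOfReal_le _ _ hC0 _)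
  suffices z = f Φ by rwa [this] at hz
  by_contra hne
  let c : 𝕜 := starRingEnd 𝕜 (z - f Φ)
  have hlim : Tendsto (fun n => RCLike.re (c * f (R n - Φ))) U (𝓝 (‖z - f Φ‖ ^ 2)) := by
    have h1 : RCLike.re (c * (z - f Φ)) = ‖z - f Φ‖ ^ 2 := by
      rw [RCLike.conj_mul]; norm_cast
    rw [← h1]
    refine (RCLike.continuous_re.tendsto _).comp (Tendsto.const_mul _ ?_)
    simp only [map_sub]
    exact hz.sub_const _
  have hpos : 0 < ‖z - f Φ‖ ^ 2 := by
    have := norm_pos_iff.2 (sub_ne_zero.2 hne)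
    positivity
  set δ := ‖z - f Φ‖ ^ 2 / 2 with hδ
  have hδ0 : 0 < δ := half_pos hpos
  have hB : ∀ᶠ n in (U : Filter ℕ), δ < RCLike.re (c * f (R n - Φ)) :=
    hlim.eventually (lt_mem_nhds (half_lt_self hpos))
  let Y : Submodule 𝕜 (lp (fun _ : T => 𝕜) ⊤) := Submodule.span 𝕜 (insert Φ (Set.range R))
  have hYsep : TopologicalSpace.IsSeparable (Y : Set (lp (fun _ : T => 𝕜) ⊤)) :=
    ((Set.countable_range R).insert Φ).isSeparable.span
  obtain ⟨t, ht⟩ := hYsep.exists_norming_seq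
  have hchoose : ∀ i : ℕ, ∃ n, δ < RCLike.re (c * f (R n - Φ)) ∧
      ∀ k ∈ Finset.range (i + 1), |F (s n) (t k) - φ (t k)| < 1 / ((i : ℝ) + 1) := by
    intro i
    refine (hB.and ((Filter.eventually_all_finset _).2 fun k _ => ?_)).exists
    have := (hφ (t k)).eventually (Metric.ball_mem_nhds _ (ε := 1 / ((i : ℝ) + 1)) (by positivity))
    exact this
  choose n hnδ hnk using hchoose
  have hconv : ∀ k, Tendsto (fun i => F (s (n i)) (t k)) atTop (𝓝 (φ (t k))) := by
    intro k
    refine tendsto_iff_dist_tendsto_zero.2 (squeeze_zero' (Eventually.of_forall fun _ => dist_nonneg)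
      ?_ tendsto_one_div_add_atTop_nhds_zero_nat)
    filter_upwards [eventually_ge_atTop k] with i hi
    exact (hnk i k (Finset.mem_range.2 (by omega))).le
  obtain ⟨w, hw0, hw1, hw⟩ := exists_convexComb_le_of_ultrafilter_tendsto_zero
    (h := fun i k => |F (s (n i)) (t k) - φ (t k)|) (C := C + C) (fun _ _ => abs_nonneg _)
    (fun i k => (abs_sub _ _).trans (add_le_add (hC _ _) (hφC _))) (by
      intro V a ha
      obtain ⟨b, -, hb⟩ := V.exists_tendsto_of_norm_le (g := fun k => φ (t k)) (C := C)
        fun k => hφC _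
      have hα : ∀ i, ∃ α : ℝ, ‖α‖ ≤ C ∧ Tendsto (fun k => F (s (n i)) (t k)) V (𝓝 α) :=
        fun i => V.exists_tendsto_of_norm_le fun k => hC _ _
      choose α hαC hα using hα
      have haα : a = fun i => |α i - b| := funext fun i =>
        tendsto_nhds_unique (ha i) ((hα i).sub hb).abs
      have hαb : Tendsto α atTop (𝓝 b) := by
        refine (tendsto_iff_ultrafilter _ _ _).2 fun U' hU' => ?_
        obtain ⟨L, -, hL⟩ := U'.exists_tendsto_of_norm_le hαC
        have : L = b := hF (fun i => s (n i)) t U' V α (fun k => φ (t k)) L b hα hL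
          (fun k => (hconv k).mono_left hU') hb
        rwa [this] at hL
      rw [haα]
      simpa using (hαb.sub_const b).abs) (ε := δ / (‖c‖ * ‖f‖ + 1)) (by positivity)
  let v : lp (fun _ : T => 𝕜) ⊤ := w.sum fun i a => (a : 𝕜) • (R (n i) - Φ)
  have hvY : v ∈ Y := Submodule.finsuppSum_mem _ _ _ _ fun i _ => Y.smul_mem _ <| Y.sub_mem
    (Submodule.subset_span (Set.mem_insert_of_mem _ ⟨_, rfl⟩))
    (Submodule.subset_span (Set.mem_insert _ _))
  have hvn : ‖v‖ ≤ δ / (‖c‖ * ‖f‖ + 1) := by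
    refine ht v hvY _ fun k => le_trans ?_ (hw k)
    have : v (t k) = ∑ i ∈ w.support, (w i : 𝕜) * ((F (s (n i)) (t k) - φ (t k) : ℝ) : 𝕜) := by
      simp only [v, Finsupp.sum, lp.coeFn_sum, Finset.sum_apply]
      refine Finset.sum_congr rfl fun i _ => ?_
      rw [lp.coeFn_smul, Pi.smul_apply, lp.coeFn_sub, Pi.sub_apply]
      simp [R, Φ]
    rw [this]
    refine (norm_sum_le _ _).trans (Finset.sum_le_sum fun i _ => ?_)
    rw [norm_mul, RCLike.norm_ofReal, RCLike.norm_ofReal, abs_of_nonneg (hw0 i)]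
  have hge : δ ≤ RCLike.re (c * f v) := by
    have : RCLike.re (c * f v) = ∑ i ∈ w.support, w i * RCLike.re (c * f (R (n i) - Φ)) := by
      simp only [v, Finsupp.sum, map_sum, Finset.mul_sum]
      refine Finset.sum_congr rfl fun i _ => ?_
      rw [map_smul, smul_eq_mul, mul_left_comm, RCLike.re_ofReal_mul]
    rw [this]
    calc δ = ∑ i ∈ w.support, w i * δ := by
          rw [← Finset.sum_mul]; simp only [Finsupp.sum] at hw1; rw [hw1, one_mul]
      _ ≤ _ := Finset.sum_le_sum fun i _ => mul_le_mul_of_nonneg_left (hnδ i).le (hw0 i)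
  have hle : RCLike.re (c * f v) ≤ ‖c‖ * ‖f‖ * (δ / (‖c‖ * ‖f‖ + 1)) := by
    refine (RCLike.re_le_norm _).trans ?_
    rw [norm_mul, mul_assoc]
    gcongr
    exact (f.le_opNorm v).trans (by gcongr)
  have hlt : ‖c‖ * ‖f‖ * (δ / (‖c‖ * ‖f‖ + 1)) < δ := by
    rw [mul_div_assoc', div_lt_iff₀ (by positivity)]
    nlinarith
  linarith

/-- The image of the unit ball of `ℓ¹` under the operator given by a bounded stable kernel satisfies
James' criterion for weak compactness. -/
theorem IsStableKernel.false_of_order_sequences [Nonempty T] (hF : IsStableKernel F)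
    (hC : ∀ s t, |F s t| ≤ C) {M r : ℝ} (f : ℕ → StrongDual 𝕜 (lp (fun _ : T => 𝕜) ⊤))
    (hf : ∀ j, ‖f j‖ ≤ M) (a : ℕ → S →₀ 𝕜) (ha : ∀ i, ((a i).sum fun _ c => ‖c‖) ≤ r)
    (x : ℕ → lp (fun _ : T => 𝕜) ⊤)
    (hx : ∀ i, x i = (a i).sum fun s c => c • lpInftyOfReal 𝕜 (F s) C (hC s))
    (hlt : ∀ i j, i < j → ‖f j (x i)‖ ≤ 1 / 4) (hge : ∀ i j, j ≤ i → ‖f j (x i) - 1‖ ≤ 1 / 4) :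
    False := by
  have hM0 : 0 ≤ M := (norm_nonneg _).trans (hf 0)
  have hr0 : 0 ≤ r := (Finset.sum_nonneg fun _ _ => norm_nonneg _).trans (ha 0)
  have hS : Nonempty S := by
    by_contra hS
    rw [not_nonempty_iff] at hS
    have h0 : x 0 = 0 := by rw [hx, Subsingleton.elim (a 0) 0]; simp
    have := hge 0 0 le_rfl
    rw [h0] at this
    norm_num at this
  have hC0 : 0 ≤ C := (abs_nonneg _).trans (hC (Classical.arbitrary S) (Classical.arbitrary T))
  obtain ⟨s, hs⟩ := ((Set.countable_iUnion fun i => (a i).support.countable_toSet).insert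
    (Classical.arbitrary S)).exists_eq_range (Set.insert_nonempty _ _)
  have hsa : ∀ i, ∀ p ∈ (a i).support, ∃ n, s n = p := fun i p hp => by
    have : p ∈ Set.range s := hs ▸ Set.mem_insert_of_mem _ (Set.mem_iUnion.2 ⟨i, hp⟩)
    exact this
  set R : ℕ → lp (fun _ : T => 𝕜) ⊤ := fun n => lpInftyOfReal 𝕜 (F (s n)) C (hC (s n)) with hR
  have hRn : ∀ n, ‖R n‖ ≤ C := fun n => norm_lpInftyOfReal_le _ _ hC0 _
  let g : ℕ → ℕ → 𝕜 := fun j n => f j (R n)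
  have hg : ∀ j n, ‖g j n‖ ≤ M * C := fun j n =>
    ((f j).le_opNorm _).trans (mul_le_mul (hf j) (hRn n) (norm_nonneg _) hM0)
  obtain ⟨c, hcm, φ, hφ, hc⟩ := (isCompact_univ_pi fun _ : ℕ =>
    isCompact_closedBall (0 : 𝕜) (M * C)).tendsto_subseq (x := g)
    (fun j n _ => by simpa using hg j n)
  have hcn : ∀ n, ‖c n‖ ≤ M * C := fun n => by simpa using hcm n (Set.mem_univ n)
  have hcg : ∀ n, Tendsto (fun k => g (φ k) n) atTop (𝓝 (c n)) := fun n =>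
    tendsto_pi_nhds.1 hc n
  have cluster : ∀ U : Ultrafilter ℕ, (U : Filter ℕ) ≤ atTop → ∃ f' : StrongDual 𝕜 _,
      (∀ y, Tendsto (fun k => f (φ k) y) U (𝓝 (f' y))) ∧ ∀ n, f' (R n) = c n := by
    intro U hU
    obtain ⟨f', hf'⟩ := U.exists_dual_tendsto_of_norm_le (fun k => hf (φ k))
    exact ⟨f', hf', fun n => tendsto_nhds_unique (hf' (R n)) ((hcg n).mono_left hU)⟩
  obtain ⟨w, hw0, hw1, hw⟩ := exists_convexComb_le_of_ultrafilter_tendsto_zero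
    (h := fun k n => ‖g (φ k) n - c n‖) (C := M * C + M * C) (fun _ _ => norm_nonneg _)
    (fun k n => (norm_sub_le _ _).trans (add_le_add (hg _ _) (hcn _))) (by
      intro V b hb
      have hψ : ∀ t, ∃ ψ : ℝ, ‖ψ‖ ≤ C ∧ Tendsto (fun n => F (s n) t) V (𝓝 ψ) := fun t =>
        V.exists_tendsto_of_norm_le fun n => hC (s n) t
      choose ψ hψC hψ using hψ
      have key := hF.tendsto_dual_apply (𝕜 := 𝕜) hC s V ψ hψC hψ
      obtain ⟨γ, -, hγ⟩ := V.exists_tendsto_of_norm_le hcn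
      have hbe : b = fun k => ‖f (φ k) (lpInftyOfReal 𝕜 ψ C hψC) - γ‖ := funext fun k =>
        tendsto_nhds_unique (hb k) ((key (f (φ k))).sub hγ).norm
      have hlim : Tendsto (fun k => f (φ k) (lpInftyOfReal 𝕜 ψ C hψC)) atTop (𝓝 γ) := by
        refine (tendsto_iff_ultrafilter _ _ _).2 fun U hU => ?_
        obtain ⟨f', hf', hf'c⟩ := cluster U hU
        have h1 : Tendsto c V (𝓝 (f' (lpInftyOfReal 𝕜 ψ C hψC))) := by
          rw [show c = fun n => f' (R n) from funext fun n => (hf'c n).symm]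
          exact key f'
        rw [tendsto_nhds_unique hγ h1]
        exact hf' _
      rw [hbe]
      simpa using (hlim.sub_const γ).norm) (ε := 1 / (8 * (r + 1))) (by positivity)
  obtain ⟨f', hf', hf'c⟩ := cluster (hyperfilter ℕ) Nat.hyperfilter_le_atTop
  let G : StrongDual 𝕜 (lp (fun _ : T => 𝕜) ⊤) := w.sum fun k b => (b : 𝕜) • f (φ k)
  have hGapp : ∀ y, G y = ∑ k ∈ w.support, (w k : 𝕜) * f (φ k) y := fun y => by
    simp [G, Finsupp.sum]
  have hw1' : ∑ k ∈ w.support, (w k : 𝕜) = 1 := by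
    have := congrArg (fun z : ℝ => (z : 𝕜)) hw1
    simpa [Finsupp.sum] using this
  have hw1r : ∑ k ∈ w.support, w k = 1 := hw1
  have hGdiff : ∀ (y : lp (fun _ : T => 𝕜) ⊤) (z : 𝕜),
      ‖G y - z‖ ≤ ∑ k ∈ w.support, w k * ‖f (φ k) y - z‖ := fun y z => by
    have : G y - z = ∑ k ∈ w.support, (w k : 𝕜) * (f (φ k) y - z) := by
      simp only [mul_sub, Finset.sum_sub_distrib, ← Finset.sum_mul, hw1', hGapp, one_mul]
    rw [this]
    refine (norm_sum_le _ _).trans (Finset.sum_le_sum fun k _ => ?_)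
    rw [norm_mul, RCLike.norm_ofReal, abs_of_nonneg (hw0 k)]
  have hGR : ∀ n, ‖(G - f') (R n)‖ ≤ 1 / (8 * (r + 1)) := fun n => by
    rw [sub_apply, hf'c]
    exact (hGdiff _ _).trans (hw n)
  have hGx : ∀ i, ‖(G - f') (x i)‖ ≤ 1 / 8 := fun i => by
    rw [hx, Finsupp.sum, map_sum]
    calc _ ≤ ∑ p ∈ (a i).support, ‖a i p‖ * (1 / (8 * (r + 1))) := by
          refine (norm_sum_le _ _).trans (Finset.sum_le_sum fun p hp => ?_)
          obtain ⟨n, rfl⟩ := hsa i p hp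
          rw [map_smul, norm_smul]
          gcongr
          exact hGR n
      _ ≤ r * (1 / (8 * (r + 1))) := by
          rw [← Finset.sum_mul]
          gcongr
          exact ha i
      _ ≤ 1 / 8 := by
          rw [mul_one_div, div_le_div_iff₀ (by positivity) (by norm_num)]
          linarith
  have hf'x : ∀ i, ‖f' (x i)‖ ≤ 1 / 4 := fun i => by
    refine le_of_tendsto (hf' (x i)).norm (Nat.hyperfilter_le_atTop ?_)
    filter_upwards [eventually_gt_atTop i] with k hk
    exact hlt _ _ (hk.trans_le (hφ.id_le k))
  let N := w.support.sup φ
  have hGN : ‖G (x N) - 1‖ ≤ 1 / 4 := by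
    refine (hGdiff _ _).trans ?_
    calc _ ≤ ∑ k ∈ w.support, w k * (1 / 4) := Finset.sum_le_sum fun k hk =>
          mul_le_mul_of_nonneg_left (hge N (φ k) (Finset.le_sup hk)) (hw0 k)
      _ = 1 / 4 := by rw [← Finset.sum_mul, hw1r, one_mul]
  have h1 : (1 : 𝕜) = f' (x N) + (G - f') (x N) - (G (x N) - 1) := by
    rw [sub_apply]; ring
  have h2 : (1 : ℝ) ≤ ‖f' (x N)‖ + ‖(G - f') (x N)‖ + ‖G (x N) - 1‖ := by
    calc (1 : ℝ) = ‖(1 : 𝕜)‖ := norm_one.symm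
      _ ≤ _ := by
        conv_lhs => rw [h1]
        exact (norm_sub_le _ _).trans (by gcongr; exact norm_add_le _ _)
  linarith [hf'x N, hGx N]

end

section Tail

variable {𝕜 : Type*} [RCLike 𝕜] {E : ℕ → Type*} [∀ n, NormedAddCommGroup (E n)]

theorem lp.norm_sq_eq_tsum (u : lp E 2) : ‖u‖ ^ 2 = ∑' n, ‖u n‖ ^ 2 := by
  simpa using lp.norm_rpow_eq_tsum (p := 2) (by simp) u

theorem lp.summable_norm_sq (u : lp E 2) : Summable fun n => ‖u n‖ ^ 2 := by
  simpa using (lp.memℓp u).summable (by simp)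

theorem lp.norm_add_sq_of_disjoint {a v : lp E 2} (h : ∀ n, a n = 0 ∨ v n = 0) :
    ‖a + v‖ ^ 2 = ‖a‖ ^ 2 + ‖v‖ ^ 2 := by
  simp only [lp.norm_sq_eq_tsum]
  rw [← (lp.summable_norm_sq a).tsum_add (lp.summable_norm_sq v)]
  refine tsum_congr fun n => ?_
  rw [lp.coeFn_add, Pi.add_apply]
  rcases h n with h | h <;> simp [h]

/-- The initial part of a sequence in an `ℓ²` sum. -/
noncomputable def lp.truncate (N : ℕ) (u : lp E 2) : lp E 2 :=
  ∑ n ∈ Finset.range N, lp.single 2 n (u n)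

theorem lp.truncate_apply (N : ℕ) (u : lp E 2) (n : ℕ) :
    lp.truncate N u n = if n < N then u n else 0 := by
  rw [lp.truncate, lp.coeFn_sum, Finset.sum_apply]
  split_ifs with h
  · rw [Finset.sum_eq_single n]
    · exact lp.single_apply_self _ _ _
    · exact fun m _ hm => lp.single_apply_ne _ _ _ (Ne.symm hm)
    · exact fun hn => absurd (Finset.mem_range.2 h) hn
  · exact Finset.sum_eq_zero fun m hm => lp.single_apply_ne _ _ _ (by
      rintro rfl; exact h (Finset.mem_range.1 hm))

theorem lp.tendsto_truncate (u : lp E 2) :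
    Tendsto (fun N => lp.truncate N u) atTop (𝓝 u) :=
  (lp.hasSum_single (by simp) u).tendsto_sum_nat

theorem lp.norm_truncate_le (N : ℕ) (u : lp E 2) : ‖lp.truncate N u‖ ≤ ‖u‖ := by
  have h := lp.norm_add_sq_of_disjoint (a := lp.truncate N u) (v := u - lp.truncate N u)
    fun n => by
      rw [lp.coeFn_sub, Pi.sub_apply, lp.truncate_apply]
      split_ifs <;> simp
  rw [add_sub_cancel] at h
  exact le_of_sq_le_sq (by nlinarith [sq_nonneg ‖u - lp.truncate N u‖]) (norm_nonneg _)

variable [∀ n, NormedSpace 𝕜 (E n)]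

/-- A bounded functional on an `ℓ²` sum is small on tails. -/
theorem lp.eventually_norm_dual_tail_le (g : StrongDual 𝕜 (lp E 2)) {η : ℝ} (hη : 0 < η) :
    ∀ᶠ N in atTop, ∀ u : lp E 2, ‖g (u - lp.truncate N u)‖ ≤ η * ‖u - lp.truncate N u‖ := by
  set τ := η / (‖g‖ + 1) with hτ
  have hτ0 : 0 < τ := by positivity
  obtain ⟨a0, ha0, hga0⟩ := g.exists_lt_apply_of_lt_opNorm (r := ‖g‖ - τ * η / 2)
    (by have := mul_pos hτ0 hη; linarith)
  filter_upwards [((g.continuous.tendsto a0).comp (lp.tendsto_truncate a0)).norm.eventually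
    (lt_mem_nhds hga0)] with N hN u
  set a := lp.truncate N a0 with ha
  set v := u - lp.truncate N u with hv
  have ha1 : ‖a‖ ≤ 1 := (lp.norm_truncate_le N a0).trans ha0.le
  rcases eq_or_ne v 0 with h0 | h0
  · simp [h0]
  have hvpos : 0 < ‖v‖ := norm_pos_iff.2 h0
  obtain ⟨c₁, hc₁, hgc₁⟩ := RCLike.exists_norm_eq_mul_self (g a)
  obtain ⟨c₂, hc₂, hgc₂⟩ := RCLike.exists_norm_eq_mul_self (g v)
  let b : 𝕜 := ((τ / ‖v‖ : ℝ) : 𝕜) * c₂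
  have hb : ‖b‖ * ‖v‖ = τ := by
    rw [norm_mul, hc₂, RCLike.norm_ofReal, abs_of_pos (by positivity)]
    field_simp
  have hdisj : ∀ n, (c₁ • a) n = 0 ∨ (b • v) n = 0 := fun n => by
    rw [lp.coeFn_smul, lp.coeFn_smul, Pi.smul_apply, Pi.smul_apply, hv, lp.coeFn_sub, Pi.sub_apply,
      ha, lp.truncate_apply, lp.truncate_apply]
    split_ifs <;> simp
  have hsq : ‖c₁ • a + b • v‖ ^ 2 ≤ 1 + τ ^ 2 := by
    rw [lp.norm_add_sq_of_disjoint hdisj, norm_smul, norm_smul, hc₁, one_mul, hb]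
    have : ‖a‖ ^ 2 ≤ 1 := pow_le_one₀ (norm_nonneg _) ha1
    linarith
  have hnorm : ‖c₁ • a + b • v‖ ≤ 1 + τ ^ 2 / 2 :=
    le_of_sq_le_sq (by nlinarith [sq_nonneg (τ ^ 2)]) (by positivity)
  have hval : g (c₁ • a + b • v) = ((‖g a‖ + τ / ‖v‖ * ‖g v‖ : ℝ) : 𝕜) := by
    rw [map_add, map_smul, map_smul, smul_eq_mul, smul_eq_mul, ← hgc₁, mul_assoc, ← hgc₂]
    push_cast
    rfl
  have hle : ‖g a‖ + τ / ‖v‖ * ‖g v‖ ≤ ‖g‖ * (1 + τ ^ 2 / 2) := by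
    have := (g.le_opNorm (c₁ • a + b • v)).trans
      (mul_le_mul_of_nonneg_left hnorm (norm_nonneg _))
    rw [hval, RCLike.norm_ofReal, abs_of_nonneg (by positivity)] at this
    exact this
  have hN' : ‖g‖ - τ * η / 2 < ‖g a‖ := hN
  have hgτ : ‖g‖ * τ ≤ η := by
    rw [hτ, mul_div_assoc', div_le_iff₀ (by positivity)]
    nlinarith [norm_nonneg g]
  have h1 : τ * (‖g v‖ / ‖v‖) ≤ τ * η := by
    have : τ / ‖v‖ * ‖g v‖ = τ * (‖g v‖ / ‖v‖) := by ring
    nlinarith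
  exact (div_le_iff₀ hvpos).1 (le_of_mul_le_mul_left h1 hτ0)

end Tail

section Renorm

variable {𝕜 : Type*} [RCLike 𝕜] {X : Type u} [NormedAddCommGroup X] [NormedSpace 𝕜 X]

/-- A seminorm is equivalent to the norm of the space. -/
class Seminorm.IsEquivNorm (p : Seminorm 𝕜 X) : Prop where
  exists_le : ∃ C : ℝ, ∀ x, p x ≤ C * ‖x‖
  exists_ge : ∃ C : ℝ, ∀ x, ‖x‖ ≤ C * p x

/-- The space `X`, with an equivalent norm. -/
def Renorm (_p : Seminorm 𝕜 X) : Type u := X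

namespace Renorm

variable (p : Seminorm 𝕜 X)

instance : AddCommGroup (Renorm p) := inferInstanceAs (AddCommGroup X)
instance : Module 𝕜 (Renorm p) := inferInstanceAs (Module 𝕜 X)

variable [p.IsEquivNorm]

noncomputable instance : NormedAddCommGroup (Renorm p) :=
  AddGroupNorm.toNormedAddCommGroup (E := Renorm p)
    { toFun := p
      map_zero' := map_zero p
      add_le' := map_add_le_add p
      neg' := map_neg_eq_map p
      eq_zero_of_map_eq_zero' := fun x hx => by
        obtain ⟨C, hC⟩ := Seminorm.IsEquivNorm.exists_ge (p := p)
        have := hC x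
        rw [hx, mul_zero] at this
        exact norm_le_zero_iff.1 this }

noncomputable instance : NormedSpace 𝕜 (Renorm p) where
  norm_smul_le c x := (map_smul_eq_mul p c x).le

/-- The identity, as an isomorphism of topological vector spaces. -/
noncomputable def equiv : X ≃L[𝕜] Renorm p :=
  LinearEquiv.toContinuousLinearEquivOfBounds (LinearEquiv.refl 𝕜 X : X ≃ₗ[𝕜] Renorm p)
    (Seminorm.IsEquivNorm.exists_le (p := p)).choose (Seminorm.IsEquivNorm.exists_ge (p := p)).choose
    (Seminorm.IsEquivNorm.exists_le (p := p)).choose_spec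
    (Seminorm.IsEquivNorm.exists_ge (p := p)).choose_spec

@[simp]
theorem norm_equiv (x : X) : ‖equiv p x‖ = p x := rfl

instance [CompleteSpace X] : CompleteSpace (Renorm p) :=
  ((equiv p).symm.isUniformEmbedding.isUniformInducing.completeSpace_congr
    (equiv p).symm.surjective).2 inferInstance

end Renorm

end Renorm

section DiagSpace

variable {𝕜 : Type*} [RCLike 𝕜] {X : Type u} [NormedAddCommGroup X] [NormedSpace 𝕜 X]
  (p : ℕ → Seminorm 𝕜 X) [∀ n, (p n).IsEquivNorm]

/-- The constant sequences in the `ℓ²` sum of the spaces `X` with the norms `p n`: the vectors `x`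
with `∑ (p n x) ^ 2 < ∞`. -/
noncomputable def diagSubmodule : Submodule 𝕜 (lp (fun n => Renorm (p n)) 2) :=
  ⨅ n, LinearMap.ker (((Renorm.equiv (p n)).symm.toContinuousLinearMap.comp (lp.evalCLM 𝕜 _ 2 n) -
    (Renorm.equiv (p 0)).symm.toContinuousLinearMap.comp (lp.evalCLM 𝕜 _ 2 0) :
      lp (fun n => Renorm (p n)) 2 →L[𝕜] X) : lp (fun n => Renorm (p n)) 2 →ₗ[𝕜] X)

theorem isClosed_diagSubmodule : IsClosed (diagSubmodule p : Set (lp (fun n => Renorm (p n)) 2)) := by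
  rw [diagSubmodule, Submodule.coe_iInf]
  exact isClosed_iInter fun n => ContinuousLinearMap.isClosed_ker _

theorem mem_diagSubmodule_iff {u : lp (fun n => Renorm (p n)) 2} :
    u ∈ diagSubmodule p ↔ ∃ x : X, ∀ n, u n = Renorm.equiv (p n) x := by
  simp only [diagSubmodule, Submodule.mem_iInf, LinearMap.mem_ker]
  constructor
  · intro h
    refine ⟨(Renorm.equiv (p 0)).symm (u 0), fun n => ?_⟩
    exact ((Renorm.equiv (p n)).symm_apply_eq).1 (sub_eq_zero.1 (h n))
  · rintro ⟨x, hx⟩ n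
    refine sub_eq_zero.2 ?_
    change (Renorm.equiv (p n)).symm (u n) = (Renorm.equiv (p 0)).symm (u 0)
    rw [hx, hx, ContinuousLinearEquiv.symm_apply_apply, ContinuousLinearEquiv.symm_apply_apply]

/-- The vectors `x` of `X` with `∑ (p n x) ^ 2 < ∞`, as a normed space. -/
def DiagSpace : Type u := diagSubmodule p

namespace DiagSpace

noncomputable instance : NormedAddCommGroup (DiagSpace p) :=
  inferInstanceAs (NormedAddCommGroup (diagSubmodule p))

noncomputable instance : NormedSpace 𝕜 (DiagSpace p) :=
  inferInstanceAs (NormedSpace 𝕜 (diagSubmodule p))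

instance [CompleteSpace X] : CompleteSpace (DiagSpace p) :=
  (isClosed_diagSubmodule p).completeSpace_coe

/-- The isometric embedding of `DiagSpace p` in the `ℓ²` sum. -/
noncomputable def toLp : DiagSpace p →ₗᵢ[𝕜] lp (fun n => Renorm (p n)) 2 :=
  (diagSubmodule p).subtypeₗᵢ

/-- The inclusion of `DiagSpace p` in `X`. -/
noncomputable def incl : DiagSpace p →L[𝕜] X :=
  ((Renorm.equiv (p 0)).symm.toContinuousLinearMap.comp (lp.evalCLM 𝕜 _ 2 0)).comp
    (toLp p).toContinuousLinearMap

theorem coe_apply (e : DiagSpace p) (n : ℕ) :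
    toLp p e n = Renorm.equiv (p n) (incl p e) := by
  obtain ⟨x, hx⟩ : ∃ x : X, ∀ n, toLp p e n = Renorm.equiv (p n) x :=
    (mem_diagSubmodule_iff p).1 (Subtype.prop e)
  have : incl p e = x := by
    change (Renorm.equiv (p 0)).symm (toLp p e 0) = x
    rw [hx, ContinuousLinearEquiv.symm_apply_apply]
  rw [hx, this]

theorem incl_injective : Function.Injective (incl p) := fun e e' h => by
  refine (toLp p).injective (lp.ext (funext fun n => ?_))
  rw [coe_apply, coe_apply, h]

theorem norm_sq (e : DiagSpace p) : ‖e‖ ^ 2 = ∑' n, p n (incl p e) ^ 2 := by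
  rw [← (toLp p).norm_map, lp.norm_sq_eq_tsum]
  simp only [coe_apply, Renorm.norm_equiv]

theorem summable (e : DiagSpace p) : Summable fun n => p n (incl p e) ^ 2 := by
  have := lp.summable_norm_sq (toLp p e)
  simpa only [coe_apply, Renorm.norm_equiv] using this

theorem apply_incl_le (e : DiagSpace p) (n : ℕ) : p n (incl p e) ≤ ‖e‖ := by
  have := lp.norm_apply_le_norm (by simp) (toLp p e) n
  rwa [coe_apply, Renorm.norm_equiv, LinearIsometry.norm_map] at this

theorem exists_incl_eq {x : X} (hx : Summable fun n => p n x ^ 2) :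
    ∃ e : DiagSpace p, incl p e = x := by
  let u : lp (fun n => Renorm (p n)) 2 := ⟨fun n => Renorm.equiv (p n) x, memℓp_gen (by simpa using hx)⟩
  have hu : u ∈ diagSubmodule p := (mem_diagSubmodule_iff p).2 ⟨x, fun n => rfl⟩
  exact ⟨⟨u, hu⟩, (Renorm.equiv (p 0)).symm_apply_apply x⟩

/-- The truncated constant sequence. -/
noncomputable def trunc (N : ℕ) : X →L[𝕜] lp (fun n => Renorm (p n)) 2 :=
  ∑ n ∈ Finset.range N, (lp.singleContinuousLinearMap 𝕜 _ 2 n).comp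
    (Renorm.equiv (p n)).toContinuousLinearMap

theorem trunc_apply (N : ℕ) (x : X) :
    trunc p N x = ∑ n ∈ Finset.range N, lp.single 2 n (Renorm.equiv (p n) x) := by
  simp [trunc]

theorem trunc_incl (N : ℕ) (e : DiagSpace p) : trunc p N (incl p e) = lp.truncate N (toLp p e) := by
  simp only [trunc_apply, lp.truncate, coe_apply]

theorem norm_trunc_sq (N : ℕ) (x : X) :
    ‖trunc p N x‖ ^ 2 = ∑ n ∈ Finset.range N, p n x ^ 2 := by
  have := lp.norm_sum_single (p := 2) (by simp) (fun n => Renorm.equiv (p n) x) (Finset.range N)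
  rw [trunc_apply]
  simpa using this

/-- An element of the bidual of `DiagSpace p` which is represented by a vector of `X` is represented
by an element of `DiagSpace p`. -/
theorem exists_eq_of_forall_comp_incl (Ξ : StrongDual 𝕜 (StrongDual 𝕜 (DiagSpace p))) (x : X)
    (hx : ∀ f : StrongDual 𝕜 X, Ξ (f.comp (incl p)) = f x) :
    ∃ e : DiagSpace p, ∀ f, Ξ f = f e := by
  have hN : ∀ N, ‖trunc p N x‖ ≤ ‖Ξ‖ := fun N => by
    obtain ⟨g, hg1, hg⟩ := exists_dual_vector'' 𝕜 (trunc p N x)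
    have h1 : ‖(g.comp (trunc p N)).comp (incl p)‖ ≤ 1 := by
      refine ContinuousLinearMap.opNorm_le_bound _ zero_le_one fun e => ?_
      rw [ContinuousLinearMap.comp_apply, ContinuousLinearMap.comp_apply, trunc_incl]
      exact (g.le_opNorm _).trans (mul_le_mul hg1 (lp.norm_truncate_le N (toLp p e)) (norm_nonneg _)
        zero_le_one) |>.trans (by simp)
    have h2 := hx (g.comp (trunc p N))
    rw [ContinuousLinearMap.comp_apply, hg] at h2
    calc ‖trunc p N x‖ = ‖((‖trunc p N x‖ : ℝ) : 𝕜)‖ := by simp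
      _ ≤ ‖Ξ‖ * 1 := by
        rw [← h2]
        exact (Ξ.le_opNorm _).trans (by gcongr)
      _ = ‖Ξ‖ := mul_one _
  have hsum : Summable fun n => p n x ^ 2 :=
    summable_of_sum_range_le (c := ‖Ξ‖ ^ 2) (fun n => sq_nonneg _) fun N => by
      rw [← norm_trunc_sq]
      exact pow_le_pow_left₀ (norm_nonneg _) (hN N) 2
  obtain ⟨e, rfl⟩ := exists_incl_eq p hsum
  refine ⟨e, fun f => ?_⟩
  obtain ⟨g, hgf⟩ : ∃ g : StrongDual 𝕜 (lp (fun n => Renorm (p n)) 2), ∀ e', g (toLp p e') = f e' := by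
    obtain ⟨g, hg, -⟩ := exists_extension_norm_eq (diagSubmodule p) f
    exact ⟨g, hg⟩
  let F : ℕ → StrongDual 𝕜 (DiagSpace p) := fun N => (g.comp (trunc p N)).comp (incl p)
  have hFapp : ∀ N e', F N e' = g (lp.truncate N (toLp p e')) := fun N e' => by
    simp only [F, ContinuousLinearMap.comp_apply, trunc_incl]
  have hF : Tendsto F atTop (𝓝 f) := by
    refine tendsto_iff_norm_sub_tendsto_zero.2 (Metric.tendsto_nhds.2 fun ε hε => ?_)
    filter_upwards [lp.eventually_norm_dual_tail_le g (η := ε / 4) (by positivity)] with N hNg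
    rw [dist_zero_right, norm_norm]
    refine (ContinuousLinearMap.opNorm_le_bound _ (M := ε / 2) (by positivity) fun e' => ?_).trans_lt
      (half_lt_self hε)
    rw [sub_apply, hFapp, ← hgf, norm_sub_rev, ← map_sub]
    refine (hNg _).trans ?_
    have h1 : ‖toLp p e' - lp.truncate N (toLp p e')‖ ≤ ‖toLp p e'‖ + ‖toLp p e'‖ :=
      (norm_sub_le _ _).trans (by gcongr; exact lp.norm_truncate_le N (toLp p e'))
    have h2 : ‖toLp p e'‖ = ‖e'‖ := (toLp p).norm_map e'
    nlinarith
  have h1 : Tendsto (fun N => Ξ (F N)) atTop (𝓝 (Ξ f)) := (Ξ.continuous.tendsto f).comp hF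
  have h2 : Tendsto (fun N => Ξ (F N)) atTop (𝓝 (f e)) := by
    have h3 : ∀ N, Ξ (F N) = g (lp.truncate N (toLp p e)) := fun N => by
      rw [hx, ContinuousLinearMap.comp_apply, trunc_incl]
    simp only [h3, ← hgf]
    exact (g.continuous.tendsto _).comp (lp.tendsto_truncate (toLp p e))
  exact tendsto_nhds_unique h1 h2

/-- `DiagSpace p` is reflexive if there are no James sequences for the vectors on which all the
norms `p n` are bounded. -/
theorem surjective_inclusionInDoubleDual [CompleteSpace X]
    (h : ∀ (R M : ℝ) (f : ℕ → StrongDual 𝕜 X) (x : ℕ → X), (∀ j, ‖f j‖ ≤ M) →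
      (∀ i n, p n (x i) ≤ R) → (∀ i j, i < j → ‖f j (x i)‖ < 1 / 8) →
      (∀ i j, j ≤ i → ‖f j (x i) - 1‖ < 1 / 8) → False) :
    Function.Surjective (NormedSpace.inclusionInDoubleDual 𝕜 (DiagSpace p)) := by
  classical
  intro Ξ
  let ξ : StrongDual 𝕜 (StrongDual 𝕜 X) := Ξ.comp (ContinuousLinearMap.precomp 𝕜 (incl p))
  have hξ : ∀ f, ξ f = Ξ (f.comp (incl p)) := fun f => rfl
  by_cases hx : ∃ x : X, ∀ f, ξ f = f x
  · obtain ⟨x, hx⟩ := hx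
    obtain ⟨e, he⟩ := exists_eq_of_forall_comp_incl p Ξ x hx
    exact ⟨e, ContinuousLinearMap.ext fun f => (he f).symm⟩
  · exfalso
    obtain ⟨M, f, x, hf, hxA, hlt, hge⟩ := exists_order_sequences_of_notMem_range ξ hx
      (A := {x | ∀ n, p n x ≤ ‖Ξ‖}) (fun s ε hε => by
        obtain ⟨e, he, hes⟩ := exists_norm_le_forall_norm_sub_lt Ξ
          (fun f : s => f.1.comp (incl p)) le_rfl hε
        exact ⟨incl p e, fun n => (apply_incl_le p e n).trans he, fun f hf => hes ⟨f, hf⟩⟩)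
      (ε := 1 / 8) (by norm_num)
    exact h ‖Ξ‖ M f x hf hxA hlt hge

end DiagSpace

end DiagSpace

section Interpolation

variable {𝕜 : Type*} [RCLike 𝕜] {X : Type u} [NormedAddCommGroup X] [NormedSpace 𝕜 X]
  {A : Type*} [AddCommGroup A] [Module 𝕜 A]

theorem interp_bddBelow (ν : Seminorm 𝕜 A) (T : A →ₗ[𝕜] X) (n : ℕ) (x : X) :
    BddBelow (Set.range fun a => (2 ^ n)⁻¹ * ν a + 2 ^ n * ‖x - T a‖) :=
  ⟨0, by rintro _ ⟨a, rfl⟩; have := apply_nonneg ν a; positivity⟩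

/-- The seminorms of the Davis–Figiel–Johnson–Pełczyński construction, in the form of
`K`-functionals. -/
noncomputable def interpSeminorm (ν : Seminorm 𝕜 A) (T : A →ₗ[𝕜] X) (n : ℕ) : Seminorm 𝕜 X :=
  Seminorm.ofSMulLE (fun x => ⨅ a, (2 ^ n)⁻¹ * ν a + 2 ^ n * ‖x - T a‖)
    (le_antisymm ((ciInf_le (interp_bddBelow ν T n 0) 0).trans (by simp))
      (Real.iInf_nonneg fun a => by have := apply_nonneg ν a; positivity))
    (fun x y => by
      refine le_ciInf_add_ciInf fun a b => (ciInf_le (interp_bddBelow ν T n _) (a + b)).trans ?_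
      have h1 := map_add_le_add ν a b
      have h2 : ‖x + y - T (a + b)‖ ≤ ‖x - T a‖ + ‖y - T b‖ := by
        rw [map_add, add_sub_add_comm]
        exact norm_add_le _ _
      calc _ ≤ (2 ^ n)⁻¹ * (ν a + ν b) + 2 ^ n * (‖x - T a‖ + ‖y - T b‖) := by gcongr
        _ = _ := by ring)
    (fun c x => by
      rw [Real.mul_iInf_of_nonneg (norm_nonneg c)]
      refine le_ciInf fun a => (ciInf_le (interp_bddBelow ν T n _) (c • a)).trans (le_of_eq ?_)
      rw [map_smul_eq_mul, map_smul, ← smul_sub, norm_smul]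
      ring)

variable (ν : Seminorm 𝕜 A) (T : A →ₗ[𝕜] X) (n : ℕ)

theorem interpSeminorm_apply (x : X) :
    interpSeminorm ν T n x = ⨅ a, (2 ^ n)⁻¹ * ν a + 2 ^ n * ‖x - T a‖ := rfl

theorem interpSeminorm_le (x : X) (a : A) :
    interpSeminorm ν T n x ≤ (2 ^ n)⁻¹ * ν a + 2 ^ n * ‖x - T a‖ :=
  ciInf_le (interp_bddBelow ν T n x) a

theorem interpSeminorm_apply_map_le (a : A) : interpSeminorm ν T n (T a) ≤ (2 ^ n)⁻¹ * ν a := by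
  simpa using interpSeminorm_le ν T n (T a) a

theorem exists_of_interpSeminorm_lt {x : X} {R : ℝ} (h : interpSeminorm ν T n x < R) :
    ∃ a, ν a ≤ 2 ^ n * R ∧ ‖x - T a‖ ≤ (2 ^ n)⁻¹ * R := by
  obtain ⟨a, ha⟩ := exists_lt_of_ciInf_lt h
  have h1 : 0 ≤ (2 ^ n)⁻¹ * ν a := by have := apply_nonneg ν a; positivity
  have h2 : 0 ≤ 2 ^ n * ‖x - T a‖ := by positivity
  refine ⟨a, ?_, ?_⟩
  · rw [← inv_mul_le_iff₀ (by positivity)]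
    linarith
  · rw [le_inv_mul_iff₀ (by positivity)]
    linarith

theorem isEquivNorm_interpSeminorm (hT : ∀ a, ‖T a‖ ≤ ν a) : (interpSeminorm ν T n).IsEquivNorm where
  exists_le := ⟨2 ^ n, fun x => by simpa using interpSeminorm_le ν T n x 0⟩
  exists_ge := ⟨2 ^ n, fun x => by
    rw [interpSeminorm_apply, Real.mul_iInf_of_nonneg (by positivity)]
    refine le_ciInf fun a => ?_
    have h1 : ‖x‖ ≤ ‖T a‖ + ‖x - T a‖ := by simpa using norm_add_le (T a) (x - T a)
    have h2 : (1 : ℝ) ≤ 2 ^ n * 2 ^ n := one_le_mul_of_one_le_of_one_le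
      (one_le_pow₀ one_le_two) (one_le_pow₀ one_le_two)
    have h3 : (2 : ℝ) ^ n * ((2 ^ n)⁻¹ * ν a + 2 ^ n * ‖x - T a‖) =
        ν a + 2 ^ n * 2 ^ n * ‖x - T a‖ := by
      field_simp
    rw [h3]
    nlinarith [hT a, norm_nonneg (x - T a)]⟩

theorem interpSeminorm_map_le {ρ : X →ₗ[𝕜] X} {σ : A → A} (hρ : ∀ x, ‖ρ x‖ = ‖x‖)
    (hσ : ∀ a, ν (σ a) = ν a) (h : ∀ a, T (σ a) = ρ (T a)) (x : X) :
    interpSeminorm ν T n (ρ x) ≤ interpSeminorm ν T n x := by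
  refine le_ciInf fun a => (interpSeminorm_le ν T n _ (σ a)).trans (le_of_eq ?_)
  rw [hσ, h, ← map_sub, hρ]

end Interpolation

section Representation

variable {𝕜 : Type*} [RCLike 𝕜] {X : Type u} [NormedAddCommGroup X] [NormedSpace 𝕜 X]
  (p : ℕ → Seminorm 𝕜 X) [∀ n, (p n).IsEquivNorm]

namespace DiagSpace

theorem exists_lift (ρ : X →ₗ[𝕜] X) (hρ : ∀ n x, p n (ρ x) = p n x) (e : DiagSpace p) :
    ∃ e' : DiagSpace p, incl p e' = ρ (incl p e) :=
  exists_incl_eq p (by simpa only [hρ] using summable p e)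

/-- The isometry of `DiagSpace p` induced by a linear map preserving all the norms `p n`. -/
noncomputable def map (ρ : X →ₗ[𝕜] X) (hρ : ∀ n x, p n (ρ x) = p n x) :
    DiagSpace p →ₗᵢ[𝕜] DiagSpace p where
  toFun e := (exists_lift p ρ hρ e).choose
  map_add' e e' := incl_injective p (by
    rw [(exists_lift p ρ hρ (e + e')).choose_spec, map_add, map_add, map_add,
      (exists_lift p ρ hρ e).choose_spec, (exists_lift p ρ hρ e').choose_spec])
  map_smul' c e := incl_injective p (by
    rw [(exists_lift p ρ hρ (c • e)).choose_spec, map_smul, map_smul, map_smul,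
      (exists_lift p ρ hρ e).choose_spec, RingHom.id_apply])
  norm_map' e := by
    refine (sq_eq_sq₀ (norm_nonneg _) (norm_nonneg _)).1 ?_
    rw [norm_sq, norm_sq]
    refine tsum_congr fun n => ?_
    change p n (incl p (exists_lift p ρ hρ e).choose) ^ 2 = _
    rw [(exists_lift p ρ hρ e).choose_spec, hρ]

@[simp]
theorem incl_map (ρ : X →ₗ[𝕜] X) (hρ : ∀ n x, p n (ρ x) = p n x) (e : DiagSpace p) :
    incl p (map p ρ hρ e) = ρ (incl p e) :=
  (exists_lift p ρ hρ e).choose_spec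

variable {G : Type*} [Group G]

/-- The representation by isometries of `DiagSpace p` induced by a representation preserving all the
norms `p n`. -/
noncomputable def rep (ρ : G →* (X →ₗ[𝕜] X)) (hρ : ∀ g n x, p n (ρ g x) = p n x) :
    G →* (DiagSpace p ≃ₗᵢ[𝕜] DiagSpace p) where
  toFun g :=
    { toLinearEquiv := LinearEquiv.ofLinearMap (map p (ρ g) (hρ g)).toLinearMap
        (map p (ρ g⁻¹) (hρ g⁻¹)).toLinearMap
        (LinearMap.ext fun e => incl_injective p (by
          change incl p (map p (ρ g) (hρ g) (map p (ρ g⁻¹) (hρ g⁻¹) e)) = incl p e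
          rw [incl_map, incl_map, ← Module.End.mul_apply, ← map_mul, mul_inv_cancel, map_one,
            Module.End.one_apply]))
        (LinearMap.ext fun e => incl_injective p (by
          change incl p (map p (ρ g⁻¹) (hρ g⁻¹) (map p (ρ g) (hρ g) e)) = incl p e
          rw [incl_map, incl_map, ← Module.End.mul_apply, ← map_mul, inv_mul_cancel, map_one,
            Module.End.one_apply]))
      norm_map' := (map p (ρ g) (hρ g)).norm_map }
  map_one' := LinearIsometryEquiv.ext fun e => incl_injective p (by
    change incl p (map p (ρ 1) (hρ 1) e) = incl p e
    rw [incl_map, map_one, Module.End.one_apply])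
  map_mul' g h := LinearIsometryEquiv.ext fun e => incl_injective p (by
    change incl p (map p (ρ (g * h)) (hρ (g * h)) e) =
      incl p (map p (ρ g) (hρ g) (map p (ρ h) (hρ h) e))
    rw [incl_map, incl_map, incl_map, map_mul, Module.End.mul_apply])

variable (ρ : G →* (X →ₗ[𝕜] X)) (hρ : ∀ g n x, p n (ρ g x) = p n x)

@[simp]
theorem incl_rep (g : G) (e : DiagSpace p) : incl p (rep p ρ hρ g e) = ρ g (incl p e) :=
  incl_map p (ρ g) (hρ g) e

/-- A family of isometries converges strongly at a point if it does so in `X`. -/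
theorem tendsto_rep {l : Filter G} {e : DiagSpace p}
    (h : Tendsto (fun g => ρ g (incl p e)) l (𝓝 (incl p e))) :
    Tendsto (fun g => rep p ρ hρ g e) l (𝓝 e) := by
  have hsq : Tendsto (fun g => ‖rep p ρ hρ g e - e‖ ^ 2) l (𝓝 0) := by
    simp only [norm_sq, map_sub, incl_rep]
    have key := tendsto_tsum_of_dominated_convergence (𝓕 := l)
      (f := fun g n => p n (ρ g (incl p e) - incl p e) ^ 2) (g := fun _ => (0 : ℝ))
      (bound := fun n => 4 * p n (incl p e) ^ 2) ((summable p e).mul_left 4)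
      (fun n => by
        obtain ⟨C, hC⟩ := Seminorm.IsEquivNorm.exists_le (p := p n)
        have h0 : Tendsto (fun g => C * ‖ρ g (incl p e) - incl p e‖) l (𝓝 0) := by
          simpa using (tendsto_iff_norm_sub_tendsto_zero.1 h).const_mul C
        simpa using (squeeze_zero (fun g => apply_nonneg (p n) _) (fun g => hC _) h0).pow 2)
      (Eventually.of_forall fun g n => by
        rw [Real.norm_of_nonneg (sq_nonneg _)]
        have h1 : p n (ρ g (incl p e) - incl p e) ≤ 2 * p n (incl p e) := by
          have := map_sub_le_add (p n) (ρ g (incl p e)) (incl p e)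
          rw [hρ] at this
          linarith
        calc _ ≤ (2 * p n (incl p e)) ^ 2 := pow_le_pow_left₀ (apply_nonneg _ _) h1 2
          _ = _ := by ring)
    simpa using key
  refine tendsto_iff_norm_sub_tendsto_zero.2 ?_
  simpa [Real.sqrt_sq (norm_nonneg _)] using hsq.sqrt

end DiagSpace

end Representation

section Embedding

variable {𝕜 : Type} [RCLike 𝕜] {G : Type*} [Group G] {E : Type u} [NormedAddCommGroup E]
  [NormedSpace 𝕜 E] (φ : G →* (E ≃ₗᵢ[𝕜] E))

theorem isometryRep_mul_apply (g h : G) (v : E) : φ (g * h) v = φ g (φ h v) := by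
  rw [map_mul]; rfl

variable [TopologicalSpace G] [IsTopologicalGroup G]

theorem continuous_apply_of_tendsto_one (h : ∀ v, Tendsto (fun g => φ g v) (𝓝 1) (𝓝 v)) (v : E) :
    Continuous fun g => φ g v := by
  refine continuous_iff_continuousAt.2 fun g => ?_
  have h1 : Tendsto (fun x => φ (g⁻¹ * x) v) (𝓝 g) (𝓝 v) := (h v).comp <| by
    have : Tendsto (fun x => g⁻¹ * x) (𝓝 g) (𝓝 (g⁻¹ * g)) := (continuous_const_mul g⁻¹).tendsto g
    rwa [inv_mul_cancel] at this
  have h2 := ((φ g).continuous.tendsto v).comp h1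
  refine h2.congr fun x => ?_
  rw [Function.comp_apply, ← isometryRep_mul_apply, mul_inv_cancel_left]

/-- A strongly continuous representation by isometries with a matrix coefficient which determines
the neighbourhoods of the identity is a topological embedding. -/
theorem isEmbedding_of_coefficient [T0Space G] (hcont : ∀ v, Tendsto (fun g => φ g v) (𝓝 1) (𝓝 v)) (v : E)
    (w : StrongDual 𝕜 E) (hw : ∀ l : Filter G, Tendsto (fun g => w (φ g v)) l (𝓝 (w v)) → l ≤ 𝓝 1) :
    IsEmbedding (fun g => isometryToSOT (φ g)) ∧ IsEmbedding (fun g => isometryToWOT (φ g)) := by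
  have hS : Continuous fun g => isometryToSOT (φ g) :=
    PointwiseConvergenceCLM.continuous_of_continuous_eval (continuous_apply_of_tendsto_one φ hcont)
  have hW : Continuous fun g => isometryToWOT (φ g) :=
    ContinuousLinearMapWOT.continuous_of_dual_apply_continuous fun x y =>
      y.continuous.comp (continuous_apply_of_tendsto_one φ hcont x)
  have key : ∀ (l : Filter G) (g : G),
      (∀ (x : E) (y : StrongDual 𝕜 E), Tendsto (fun h => y (φ h x)) l (𝓝 (y (φ g x)))) →
      l ≤ 𝓝 g := by
    intro l g h
    have h1 := hw (l.map fun x => g⁻¹ * x) (by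
      refine tendsto_map'_iff.2 ?_
      have h2 := h v (w.comp ((φ g⁻¹).toContinuousLinearEquiv : E →L[𝕜] E))
      refine (h2.congr fun x => ?_).trans (le_of_eq ?_)
      · change w (φ g⁻¹ (φ x v)) = w (φ (g⁻¹ * x) v)
        rw [isometryRep_mul_apply]
      · congr 1
        change w (φ g⁻¹ (φ g v)) = w v
        rw [← isometryRep_mul_apply, inv_mul_cancel, map_one]
        rfl)
    have h3 : Tendsto (fun x => g * (g⁻¹ * x)) l (𝓝 g) := by
      have := ((continuous_const_mul g).tendsto 1).comp (tendsto_map'_iff.1 (tendsto_id'.2 h1))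
      rwa [mul_one] at this
    simpa [Tendsto] using h3
  constructor
  · refine IsInducing.isEmbedding (isInducing_iff_nhds.2 fun g => le_antisymm
      (hS.tendsto g).le_comap (key _ g fun x y => ?_))
    exact (y.continuous.tendsto _).comp
      ((PointwiseConvergenceCLM.tendsto_iff_forall_tendsto.1 tendsto_comap) x)
  · refine IsInducing.isEmbedding (isInducing_iff_nhds.2 fun g => le_antisymm
      (hW.tendsto g).le_comap (key _ g fun x y => ?_))
    exact (ContinuousLinearMapWOT.tendsto_iff_forall_dual_apply_tendsto.1 tendsto_comap) x y

end Embedding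

section Bump

variable {G : Type u} [MetricSpace G]

/-- The kernel `max 0 (1 - d (s, t))`. -/
noncomputable def bump (s t : G) : ℝ := max 0 (1 - dist s t)

theorem bump_nonneg (s t : G) : 0 ≤ bump s t := le_max_left _ _

theorem bump_comm (s t : G) : bump s t = bump t s := by rw [bump, bump, dist_comm]

@[simp]
theorem bump_self (s : G) : bump s s = 1 := by simp [bump]

theorem abs_bump_le (s t : G) : |bump s t| ≤ 1 := by
  rw [abs_of_nonneg (bump_nonneg s t)]
  exact max_le zero_le_one (by linarith [dist_nonneg (x := s) (y := t)])

theorem dist_lt_one_of_bump_pos {s t : G} (h : 0 < bump s t) : dist s t < 1 := by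
  by_contra! h1
  rw [bump, max_eq_left (by linarith)] at h
  exact lt_irrefl _ h

theorem abs_bump_sub_bump_le (s s' t : G) : |bump s t - bump s' t| ≤ dist s s' := by
  refine (abs_max_sub_max_le_max 0 (1 - dist s t) 0 (1 - dist s' t)).trans ?_
  rw [sub_self, abs_zero, sub_sub_sub_cancel_left, abs_sub_comm]
  exact max_le dist_nonneg (abs_dist_sub_le s s' t)

variable [Group G]

/-- If the metric is stable, then the kernel `bump` has interchangeable iterated limits along all
sequences, bounded or not. -/
theorem IsStableMetric.isStableKernel_bump (h : IsStableMetric G) :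
    IsStableKernel (bump : G → G → ℝ) := by
  have aux : ∀ (s t : ℕ → G) (U V : Ultrafilter ℕ) (a b : ℕ → ℝ) (L L' : ℝ),
      (∀ n, Tendsto (fun m => bump (s n) (t m)) V (𝓝 (a n))) → Tendsto a U (𝓝 L) →
      (∀ m, Tendsto (fun n => bump (s n) (t m)) U (𝓝 (b m))) → Tendsto b V (𝓝 L') →
      0 < L → L = L' := by
    classical
    intro s t U V a b L L' ha hL hb hL' hpos
    have hU : ∀ᶠ n in (U : Filter ℕ), 0 < a n := hL.eventually (lt_mem_nhds hpos)
    have hV : ∀ n, 0 < a n → ∀ᶠ m in (V : Filter ℕ), dist (s n) (t m) < 1 := fun n hn =>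
      ((ha n).eventually (lt_mem_nhds hn)).mono fun m hm => dist_lt_one_of_bump_pos hm
    obtain ⟨n₀, hn₀⟩ := hU.exists
    set R := dist 1 (s n₀) + 2 with hR
    have hR0 : 0 ≤ R := by positivity
    have hVR : ∀ᶠ m in (V : Filter ℕ), dist 1 (t m) ≤ R := (hV n₀ hn₀).mono fun m hm => by
      linarith [dist_triangle 1 (s n₀) (t m)]
    have hUR : ∀ᶠ n in (U : Filter ℕ), dist 1 (s n) ≤ R := hU.mono fun n hn => by
      obtain ⟨m, hm, hm'⟩ := ((hV n hn).and (hV n₀ hn₀)).exists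
      rw [dist_comm] at hm
      linarith [dist_triangle 1 (s n₀) (t m), dist_triangle 1 (t m) (s n)]
    let s' : ℕ → G := fun n => if dist 1 (s n) ≤ R then s n else 1
    let t' : ℕ → G := fun m => if dist 1 (t m) ≤ R then t m else 1
    have hs' : ∀ n, dist 1 (s' n) ≤ R := fun n => by
      simp only [s']; split_ifs with h1
      · exact h1
      · simpa using hR0
    have ht' : ∀ m, dist 1 (t' m) ≤ R := fun m => by
      simp only [t']; split_ifs with h1
      · exact h1
      · simpa using hR0
    have hd : ∀ n m, ‖dist (s' n) (t' m)‖ ≤ R + R := fun n m => by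
      rw [Real.norm_of_nonneg dist_nonneg]
      have := dist_triangle_left (s' n) (t' m) 1
      linarith [hs' n, ht' m]
    choose a' ha'R ha' using fun n => V.exists_tendsto_of_norm_le (hd n)
    choose b' hb'R hb' using fun m => U.exists_tendsto_of_norm_le (fun n => hd n m)
    obtain ⟨K, -, hK⟩ := U.exists_tendsto_of_norm_le ha'R
    obtain ⟨K', -, hK'⟩ := V.exists_tendsto_of_norm_le hb'R
    have hKK : K = K' := h s' t' ⟨R, hs', ht'⟩ U V a' b' K K' ha' hK hb' hK'
    have hψ : Continuous fun r : ℝ => max 0 (1 - r) := by fun_prop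
    have haa : ∀ᶠ n in (U : Filter ℕ), max 0 (1 - a' n) = a n := hUR.mono fun n hn => by
      refine tendsto_nhds_unique_of_eventuallyEq ((hψ.tendsto _).comp (ha' n)) (ha n)
        (hVR.mono fun m hm => ?_)
      simp only [Function.comp_apply, s', t', if_pos hn, if_pos hm, bump]
    have hbb : ∀ᶠ m in (V : Filter ℕ), max 0 (1 - b' m) = b m := hVR.mono fun m hm => by
      refine tendsto_nhds_unique_of_eventuallyEq ((hψ.tendsto _).comp (hb' m)) (hb m)
        (hUR.mono fun n hn => ?_)
      simp only [Function.comp_apply, s', t', if_pos hn, if_pos hm, bump]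
    have hL1 : max 0 (1 - K) = L :=
      tendsto_nhds_unique_of_eventuallyEq ((hψ.tendsto _).comp hK) hL haa
    have hL2 : max 0 (1 - K') = L' :=
      tendsto_nhds_unique_of_eventuallyEq ((hψ.tendsto _).comp hK') hL' hbb
    rw [← hL1, ← hL2, hKK]
  intro s t U V a b L L' ha hL hb hL'
  have ha0 : ∀ n, 0 ≤ a n := fun n => ge_of_tendsto' (ha n) fun m => bump_nonneg _ _
  have hb0 : ∀ m, 0 ≤ b m := fun m => ge_of_tendsto' (hb m) fun n => bump_nonneg _ _
  have hL0 : 0 ≤ L := ge_of_tendsto' hL ha0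
  have hL0' : 0 ≤ L' := ge_of_tendsto' hL' hb0
  rcases hL0.eq_or_lt with h0 | h0
  · rcases hL0'.eq_or_lt with h0' | h0'
    · rw [← h0, ← h0']
    · refine (aux t s V U b a L' L (fun m => ?_) hL' (fun n => ?_) hL h0').symm
      · simpa only [bump_comm] using hb m
      · simpa only [bump_comm] using ha n
  · exact aux s t U V a b L L' ha hL hb hL' h0

end Bump

section Translation

variable {G : Type u} [Group G] (𝕜 : Type) [RCLike 𝕜]

/-- Left translations of bounded functions on a group. -/
noncomputable def leftTranslation : G →* (lp (fun _ : G => 𝕜) ⊤ →ₗ[𝕜] lp (fun _ : G => 𝕜) ⊤) where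
  toFun g :=
    { toFun := fun x => ⟨fun t => x (g⁻¹ * t), memℓp_infty ⟨‖x‖, by
        rintro _ ⟨t, rfl⟩
        exact lp.norm_apply_le_norm ENNReal.top_ne_zero x _⟩⟩
      map_add' := fun x y => rfl
      map_smul' := fun c x => rfl }
  map_one' := LinearMap.ext fun x => lp.ext <| funext fun t => congrArg x (by simp)
  map_mul' g h := LinearMap.ext fun x => lp.ext <| funext fun t => congrArg x (by
    simp [mul_assoc])

variable {𝕜}

theorem leftTranslation_inv_apply_self (g : G) (x : lp (fun _ : G => 𝕜) ⊤) :
    leftTranslation 𝕜 g⁻¹ (leftTranslation 𝕜 g x) = x :=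
  lp.ext <| funext fun t => congrArg x (by simp)

theorem norm_leftTranslation_apply (g : G) (x : lp (fun _ : G => 𝕜) ⊤) :
    ‖leftTranslation 𝕜 g x‖ = ‖x‖ := by
  have hle : ∀ (g : G) (x : lp (fun _ : G => 𝕜) ⊤), ‖leftTranslation 𝕜 g x‖ ≤ ‖x‖ := fun g x =>
    lp.norm_le_of_forall_le (norm_nonneg _) fun t => lp.norm_apply_le_norm ENNReal.top_ne_zero x _
  refine (hle g x).antisymm ?_
  have := hle g⁻¹ (leftTranslation 𝕜 g x)
  rwa [leftTranslation_inv_apply_self] at this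

end Translation

/-- The `ℓ¹` norm on finitely supported functions. -/
noncomputable def Finsupp.l1Seminorm (𝕜 S : Type*) [RCLike 𝕜] : Seminorm 𝕜 (S →₀ 𝕜) :=
  Seminorm.of (fun a => a.sum fun _ c => ‖c‖)
    (fun a b => by
      classical
      have h : ∀ c : S →₀ 𝕜, c.support ⊆ a.support ∪ b.support →
          (c.sum fun _ c => ‖c‖) = ∑ s ∈ a.support ∪ b.support, ‖c s‖ := fun c hc =>
        Finsupp.sum_of_support_subset _ hc _ (by simp)
      rw [h _ Finsupp.support_add, h a Finset.subset_union_left, h b Finset.subset_union_right,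
        ← Finset.sum_add_distrib]
      exact Finset.sum_le_sum fun s _ => norm_add_le _ _)
    (fun c a => by
      rcases eq_or_ne c 0 with rfl | hc
      · simp
      · rw [Finsupp.sum_smul_index' (by simp), Finsupp.mul_sum]
        simp only [norm_smul])

theorem Finsupp.l1Seminorm_apply {𝕜 S : Type*} [RCLike 𝕜] (a : S →₀ 𝕜) :
    Finsupp.l1Seminorm 𝕜 S a = a.sum fun _ c => ‖c‖ := rfl

section Main

variable {G : Type u} [MetricSpace G] (𝕜 : Type) [RCLike 𝕜]

/-- The function `t ↦ max 0 (1 - d (s, t))`. -/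
noncomputable def bumpRow (s : G) : lp (fun _ : G => 𝕜) ⊤ :=
  lpInftyOfReal 𝕜 (bump s) 1 (abs_bump_le s)

/-- The operator on finitely supported functions with the kernel `bump`. -/
noncomputable def bumpOperator : (G →₀ 𝕜) →ₗ[𝕜] lp (fun _ : G => 𝕜) ⊤ :=
  Finsupp.linearCombination 𝕜 (bumpRow 𝕜)

theorem norm_bumpOperator_le (a : G →₀ 𝕜) : ‖bumpOperator 𝕜 a‖ ≤ Finsupp.l1Seminorm 𝕜 G a := by
  rw [bumpOperator, Finsupp.linearCombination_apply, Finsupp.l1Seminorm_apply]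
  refine (norm_sum_le _ _).trans (Finset.sum_le_sum fun s _ => ?_)
  rw [norm_smul]
  exact mul_le_of_le_one_right (norm_nonneg _) (norm_lpInftyOfReal_le _ _ zero_le_one _)

/-- The norms defining the reflexive space associated with the kernel `bump`. -/
noncomputable def bumpSeminorm (n : ℕ) : Seminorm 𝕜 (lp (fun _ : G => 𝕜) ⊤) :=
  interpSeminorm (Finsupp.l1Seminorm 𝕜 G) (bumpOperator 𝕜) n

instance (n : ℕ) : (bumpSeminorm (G := G) 𝕜 n).IsEquivNorm :=
  isEquivNorm_interpSeminorm _ _ n (norm_bumpOperator_le 𝕜)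

variable {𝕜}

theorem incl_mem_closure_range (e : DiagSpace (bumpSeminorm (G := G) 𝕜)) :
    DiagSpace.incl _ e ∈ closure (Set.range (bumpOperator (G := G) 𝕜)) := by
  refine Metric.mem_closure_iff.2 fun ε hε => ?_
  obtain ⟨n, hn⟩ := pow_unbounded_of_one_lt ((‖e‖ + 1) / ε) (one_lt_two (α := ℝ))
  obtain ⟨a, -, ha⟩ := exists_of_interpSeminorm_lt _ _ n
    ((DiagSpace.apply_incl_le _ e n).trans_lt (lt_add_one ‖e‖))
  refine ⟨_, ⟨a, rfl⟩, ?_⟩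
  rw [dist_eq_norm]
  refine ha.trans_lt ?_
  rw [inv_mul_lt_iff₀ (by positivity)]
  rwa [div_lt_iff₀ hε] at hn

theorem summable_bumpSeminorm_bumpRow (s : G) :
    Summable fun n => bumpSeminorm 𝕜 n (bumpRow 𝕜 s) ^ 2 := by
  have hle : ∀ n, bumpSeminorm 𝕜 n (bumpRow 𝕜 s) ≤ (2 ^ n)⁻¹ := fun n => by
    have := interpSeminorm_apply_map_le (Finsupp.l1Seminorm 𝕜 G) (bumpOperator 𝕜) n
      (Finsupp.single s 1)
    rw [bumpOperator, Finsupp.linearCombination_single, one_smul, Finsupp.l1Seminorm_apply,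
      Finsupp.sum_single_index (by simp), norm_one, mul_one] at this
    exact this
  refine Summable.of_nonneg_of_le (fun n => sq_nonneg _)
    (fun n => pow_le_pow_left₀ (apply_nonneg _ _) (hle n) 2) ?_
  have := summable_geometric_of_lt_one (r := (1 / 4 : ℝ)) (by norm_num) (by norm_num)
  refine this.congr fun n => ?_
  rw [← inv_pow, ← pow_mul, mul_comm, pow_mul]
  norm_num

variable (𝕜)

variable [Group G]

theorem surjective_inclusionInDoubleDual_bump (h : IsStableMetric G) : Function.Surjective
    (NormedSpace.inclusionInDoubleDual 𝕜 (DiagSpace (bumpSeminorm (G := G) 𝕜))) := by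
  refine DiagSpace.surjective_inclusionInDoubleDual _ fun R M f x hf hx hlt hge => ?_
  have hM : 0 ≤ M := (norm_nonneg _).trans (hf 0)
  have hR : 0 ≤ R := (apply_nonneg _ _).trans (hx 0 0)
  obtain ⟨n, hn⟩ := pow_unbounded_of_one_lt (8 * (M * (R + 1))) (one_lt_two (α := ℝ))
  choose a ha hxa using fun i => exists_of_interpSeminorm_lt _ _ n
    ((hx i n).trans_lt (lt_add_one R))
  have hsmall : ∀ i j, ‖f j (bumpOperator 𝕜 (a i)) - f j (x i)‖ ≤ 1 / 8 := fun i j => by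
    rw [← map_sub, ← norm_neg, ← map_neg, neg_sub]
    calc _ ≤ M * ((2 ^ n)⁻¹ * (R + 1)) := ((f j).le_opNorm _).trans
          (mul_le_mul (hf j) (hxa i) (norm_nonneg _) hM)
      _ = M * (R + 1) / 2 ^ n := by ring
      _ ≤ 1 / 8 := by
        rw [div_le_div_iff₀ (by positivity) (by norm_num)]
        linarith
  have hop : ∀ i, bumpOperator 𝕜 (a i) =
      (a i).sum fun s c => c • lpInftyOfReal 𝕜 (bump s) 1 (abs_bump_le s) := fun i => by
    rw [bumpOperator, Finsupp.linearCombination_apply]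
    rfl
  refine h.isStableKernel_bump.false_of_order_sequences abs_bump_le (r := 2 ^ n * (R + 1)) f hf a
    (fun i => by simpa only [Finsupp.l1Seminorm_apply] using ha i)
    (fun i => bumpOperator 𝕜 (a i)) hop (fun i j hij => ?_) (fun i j hij => ?_)
  · have := norm_add_le (f j (bumpOperator 𝕜 (a i)) - f j (x i)) (f j (x i))
    rw [sub_add_cancel] at this
    linarith [hsmall i j, hlt i j hij]
  · have := norm_add_le (f j (bumpOperator 𝕜 (a i)) - f j (x i)) (f j (x i) - 1)
    rw [sub_add_sub_cancel] at this
    linarith [hsmall i j, hge i j hij]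

variable {𝕜}

theorem leftTranslation_bumpRow (hd : ∀ g x y : G, dist (g * x) (g * y) = dist x y) (g s : G) :
    leftTranslation 𝕜 g (bumpRow 𝕜 s) = bumpRow 𝕜 (g * s) := by
  refine lp.ext (funext fun t => ?_)
  change ((bump s (g⁻¹ * t) : ℝ) : 𝕜) = (bump (g * s) t : ℝ)
  rw [bump, bump, ← hd g s, mul_inv_cancel_left]

theorem bumpSeminorm_leftTranslation (hd : ∀ g x y : G, dist (g * x) (g * y) = dist x y) (g : G)
    (n : ℕ) (x : lp (fun _ : G => 𝕜) ⊤) :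
    bumpSeminorm 𝕜 n (leftTranslation 𝕜 g x) = bumpSeminorm 𝕜 n x := by
  have hle : ∀ (g : G) (x : lp (fun _ : G => 𝕜) ⊤),
      bumpSeminorm 𝕜 n (leftTranslation 𝕜 g x) ≤ bumpSeminorm 𝕜 n x := fun g x =>
    interpSeminorm_map_le (Finsupp.l1Seminorm 𝕜 G) (bumpOperator 𝕜) n (ρ := leftTranslation 𝕜 g)
      (σ := fun a => a.mapDomain (g * ·)) (fun y => norm_leftTranslation_apply g y)
      (fun a => by
        rw [Finsupp.l1Seminorm_apply, Finsupp.l1Seminorm_apply,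
          Finsupp.sum_mapDomain_index_inj (mul_right_injective g)])
      (fun a => by
        rw [bumpOperator, Finsupp.linearCombination_mapDomain, Finsupp.linearCombination_apply,
          Finsupp.linearCombination_apply, Finsupp.sum, Finsupp.sum, map_sum]
        refine Finset.sum_congr rfl fun s _ => ?_
        rw [map_smul, leftTranslation_bumpRow hd]
        rfl) x
  refine (hle g x).antisymm ?_
  have := hle g⁻¹ (leftTranslation 𝕜 g x)
  rwa [leftTranslation_inv_apply_self] at this

theorem tendsto_leftTranslation_of_mem_closure [IsTopologicalGroup G]
    (hd : ∀ g x y : G, dist (g * x) (g * y) = dist x y) {x : lp (fun _ : G => 𝕜) ⊤}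
    (hx : x ∈ closure (Set.range (bumpOperator (G := G) 𝕜))) :
    Tendsto (fun g => leftTranslation 𝕜 g x) (𝓝 1) (𝓝 x) := by
  have hrow : ∀ s : G, Tendsto (fun g => leftTranslation 𝕜 g (bumpRow 𝕜 s)) (𝓝 1)
      (𝓝 (bumpRow 𝕜 s)) := fun s => by
    have h1 : Tendsto (fun g : G => dist (g * s) s) (𝓝 1) (𝓝 0) := by
      have : Tendsto (fun g : G => g * s) (𝓝 1) (𝓝 (1 * s)) := (continuous_mul_const s).tendsto 1
      rw [one_mul] at this
      exact tendsto_iff_dist_tendsto_zero.1 this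
    refine tendsto_iff_norm_sub_tendsto_zero.2
      (squeeze_zero (fun _ => norm_nonneg _) (fun g => ?_) h1)
    rw [leftTranslation_bumpRow hd]
    refine lp.norm_le_of_forall_le dist_nonneg fun t => ?_
    change ‖((bump (g * s) t : ℝ) : 𝕜) - (bump s t : ℝ)‖ ≤ _
    rw [← RCLike.ofReal_sub, RCLike.norm_ofReal]
    exact abs_bump_sub_bump_le _ _ _
  have hop : ∀ a : G →₀ 𝕜, Tendsto (fun g => leftTranslation 𝕜 g (bumpOperator 𝕜 a)) (𝓝 1)
      (𝓝 (bumpOperator 𝕜 a)) := fun a => by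
    simp only [bumpOperator, Finsupp.linearCombination_apply, Finsupp.sum, map_sum, map_smul]
    exact tendsto_finsetSum _ fun s _ => (hrow s).const_smul _
  refine Metric.tendsto_nhds.2 fun ε hε => ?_
  obtain ⟨_, ⟨a, rfl⟩, ha⟩ := Metric.mem_closure_iff.1 hx (ε / 3) (by positivity)
  filter_upwards [Metric.tendsto_nhds.1 (hop a) (ε / 3) (by positivity)] with g hg
  have h1 : dist (leftTranslation 𝕜 g x) (leftTranslation 𝕜 g (bumpOperator 𝕜 a)) < ε / 3 := by
    rwa [dist_eq_norm, ← map_sub, norm_leftTranslation_apply, ← dist_eq_norm]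
  rw [dist_comm] at ha
  linarith [dist_triangle4 (leftTranslation 𝕜 g x) (leftTranslation 𝕜 g (bumpOperator 𝕜 a))
    (bumpOperator 𝕜 a) x]

theorem le_nhds_one_of_tendsto_bump {l : Filter G} (h : Tendsto (fun g : G => bump g 1) l (𝓝 1)) :
    l ≤ 𝓝 1 := by
  refine tendsto_id'.1 (Metric.tendsto_nhds.2 fun ε hε => ?_)
  have hpos : 0 < min ε 1 := lt_min hε one_pos
  filter_upwards [h.eventually (lt_mem_nhds (show 1 - min ε 1 < 1 by linarith))] with g hg
  have h1 : dist g 1 < min ε 1 := by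
    rcases lt_max_iff.1 hg with h0 | h0
    · linarith [min_le_right ε 1]
    · linarith
  exact h1.trans_le (min_le_left _ _)

end Main

theorem proposition3p2 {G : Type u} [Group G] [MetricSpace G] [IsTopologicalGroup G]
    (left_invariant : ∀ g x y : G, dist (g * x) (g * y) = dist x y)
    (stable : IsStableMetric G) (𝕜 : Type) [RCLike 𝕜] :
    ReflexivelyRepresentable 𝕜 G := by
  obtain ⟨v, hv⟩ := DiagSpace.exists_incl_eq _ (summable_bumpSeminorm_bumpRow (𝕜 := 𝕜) (1 : G))
  refine ⟨DiagSpace (bumpSeminorm (G := G) 𝕜), inferInstance, inferInstance,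
    ⟨inferInstance, surjective_inclusionInDoubleDual_bump 𝕜 stable⟩,
    DiagSpace.rep _ (leftTranslation 𝕜) (bumpSeminorm_leftTranslation left_invariant),
    isEmbedding_of_coefficient _ (fun e => DiagSpace.tendsto_rep _ _ _
      (tendsto_leftTranslation_of_mem_closure left_invariant (incl_mem_closure_range e))) v
      ((lp.evalCLM 𝕜 (fun _ : G => 𝕜) ⊤ 1).comp (DiagSpace.incl _)) fun l hl => ?_⟩
  have hcoef : ∀ g : G, (lp.evalCLM 𝕜 (fun _ : G => 𝕜) ⊤ 1).comp (DiagSpace.incl _)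
      (DiagSpace.rep (bumpSeminorm 𝕜) (leftTranslation 𝕜)
        (bumpSeminorm_leftTranslation left_invariant) g v) = ((bump g 1 : ℝ) : 𝕜) := fun g => by
    rw [ContinuousLinearMap.comp_apply, DiagSpace.incl_rep, hv,
      leftTranslation_bumpRow left_invariant, mul_one]
    rfl
  have hcoef1 : (lp.evalCLM 𝕜 (fun _ : G => 𝕜) ⊤ 1).comp (DiagSpace.incl _) v =
      ((1 : ℝ) : 𝕜) := by
    rw [ContinuousLinearMap.comp_apply, hv, ← bump_self (1 : G)]
    rfl
  simp only [hcoef, hcoef1] at hl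
  refine le_nhds_one_of_tendsto_bump ?_
  simpa [Function.comp_def] using (RCLike.continuous_re.tendsto _).comp hl
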